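/- **Setting.** Let $\mathcal X=\{a,b,c,d\}$. A *poly-quantoid* on $\mathcal X$ is a function $S:2^{\mathcal X}\to\mathbb R$ with $S(\emptyset)=0$, $S(J)\ge 0$ for all $J$, and, for all $A,B\subseteq\mathcal X$, $$S(A)+S(B)-S(A\cap B)-S(A\cup B)\ge 0,\qquad S(A)+S(B)-S(A\setminus B)-S(B\setminus A)\ge 0 .$$ Add a fifth (purifying) party $e$ and extend $S$ to the subsets of $\mathcal X\cup\{e\}$ by complementarity: $S(J):=S((\mathcal X\cup\{e\})\setminus J)$ if $e\in J$. Write $I(A:B)=S(A)+S(B)-S(AB)$ and $I(A:B|C)=S(AC)+S(BC)-S(ABC)-S(C)$. The *Ingleton inequality and all its permutations* are the inequalities $$I(A:B|C)+I(A:B|D)+I(C:D)-I(A:B)\ \ge\ 0$$ for all choices of four distinct parties $A,B,C,D$ among the five parties $a,b,c,d,e$. An *abstract error group* on a finite-dimensional Hilbert space $\mathcal H$ is a finite group $W$ of unitaries on $\mathcal H$ whose center $C$ consists of multiples of the identity, such that $W/C$ is abelian of order $(\dim\mathcal H)^2$ and $\operatorname{Tr} g=0$ for every $g\in W\setminus C$.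 A *five-party (pure) stabiliser state* is a unit vector $\psi\in\bigotimes_{x\in\{a,b,c,d,e\}}\mathcal H_x$ (with arbitrary finite-dimensional $\mathcal H_x$) that is a simultaneous eigenvector of all elements of some maximal abelian subgroup $G$ of $\bigotimes_x W_x$, where each $W_x$ is an abstract error group on $\mathcal H_x$. Its *four-party entropy vector* is $J\mapsto -\operatorname{Tr}\rho_J\log\rho_J$ for $J\subseteq\{a,b,c,d\}$, where $\rho_J$ is the reduced state of $|\psi\rangle\langle\psi|$ on the parties in $J$. A poly-quantoid on $\mathcal X$ is *stabiliser-represented* if it lies in the closure, in $\mathbb R^{2^{\mathcal X}}$, of the convex cone generated by the four-party entropy vectors of all five-party stabiliser states. **Theorem.** A $4$-party poly-quantoid is stabiliser-represented if and only if it satisfies the Ingleton inequality and all its permutations. -/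

import Mathlib

open Matrix

noncomputable section

namespace StabCone

/-! ### Poly-quantoids and the Ingleton expression -/

section Cone

variable {α : Type*} [Fintype α] [DecidableEq α]

/-- A poly-quantoid: a real set function satisfying non-negativity, strong subadditivity and
weak monotonicity, for all (not necessarily disjoint) subsets of the set of parties. -/
structure IsPolyQuantoid (S : Finset α → ℝ) : Prop where
  nonneg : ∀ A, 0 ≤ S A
  empty : S ∅ = 0
  ssa : ∀ A B, 0 ≤ S A + S B - S (A ∩ B) - S (A ∪ B)
  wmo : ∀ A B, 0 ≤ S A + S B - S (A \ B) - S (B \ A)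

/-- The mutual information `I(A : B)`. -/
def mutualInfo (S : Finset α → ℝ) (A B : Finset α) : ℝ :=
  S A + S B - S (A ∪ B)

/-- The conditional mutual information `I(A : B | C)`. -/
def condMutualInfo (S : Finset α → ℝ) (A B C : Finset α) : ℝ :=
  S (A ∪ C) + S (B ∪ C) - S (A ∪ B ∪ C) - S C

/-- The Ingleton expression `Ing(A B : C D)`. -/
def ingleton (S : Finset α → ℝ) (A B C D : Finset α) : ℝ :=
  condMutualInfo S A B C + condMutualInfo S A B D + mutualInfo S C D - mutualInfo S A B

end Cone

/-- The subset of the first `N` parties that a set of `N + 1` parties contains. -/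
def restrictParties {N : ℕ} (J : Finset (Fin (N + 1))) : Finset (Fin N) :=
  Finset.univ.filter fun i => i.castSucc ∈ J

/-- The extension of an `N`-party vector to `N + 1` parties, the last one being the purifying
party, through the complementarity relation `S(J) = S(Jᶜ)`. -/
def purification {N : ℕ} (S : Finset (Fin N) → ℝ) (J : Finset (Fin (N + 1))) : ℝ :=
  if Fin.last N ∈ J then S (restrictParties Jᶜ) else S (restrictParties J)

/-- The Ingleton inequality and all its permutations, for the four-party vector `S` seen as a
vector on five parties through complementarity: `Ing(A B : C D) ≥ 0` for every choice of four
distinct parties among the five. -/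
def SatisfiesIngleton (S : Finset (Fin 4) → ℝ) : Prop :=
  ∀ σ : Equiv.Perm (Fin 5),
    0 ≤ ingleton (purification S) {σ 0} {σ 1} {σ 2} {σ 3}

/-! ### Entropies of the reduced states of a pure multi-party state -/

section Entropy

/-- The von Neumann entropy `-Tr ρ log ρ` of a Hermitian matrix, computed from its eigenvalues. -/
def vonNeumannEntropy {n : Type*} [Fintype n] [DecidableEq n]
    (ρ : Matrix n n ℂ) (hρ : ρ.IsHermitian) : ℝ :=
  ∑ i, Real.negMulLog (hρ.eigenvalues i)

variable {P : Type*} [Fintype P] [DecidableEq P] {d : P → ℕ}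

/-- The rank-one operator `|ψ⟩⟨ψ|`. -/
def pureState {n : Type*} (ψ : n → ℂ) : Matrix n n ℂ :=
  vecMulVec ψ (star ψ)

/-- The basis index of the whole system with components `i` on `J` and `k` off `J`. -/
def glue (J : Finset P) (i : ∀ x : {x // x ∈ J}, Fin (d x))
    (k : ∀ x : {x // x ∉ J}, Fin (d x)) : ∀ x, Fin (d x) :=
  fun x => if h : x ∈ J then i ⟨x, h⟩ else k ⟨x, h⟩

/-- The reduced operator on the parties in `J`: the partial trace over the parties off `J`. -/
def reducedState (ρ : Matrix (∀ x, Fin (d x)) (∀ x, Fin (d x)) ℂ) (J : Finset P) :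
    Matrix (∀ x : {x // x ∈ J}, Fin (d x)) (∀ x : {x // x ∈ J}, Fin (d x)) ℂ :=
  Matrix.of fun i j => ∑ k : ∀ x : {x // x ∉ J}, Fin (d x), ρ (glue J i k) (glue J j k)

theorem isHermitian_reducedState (ψ : (∀ x, Fin (d x)) → ℂ) (J : Finset P) :
    (reducedState (pureState ψ) J).IsHermitian := by
  ext i j
  simp [reducedState, pureState, vecMulVec_apply, mul_comm]

/-- The entropy of the reduced state, on the parties in `J`, of the pure state `ψ`. -/
def reducedEntropy (ψ : (∀ x, Fin (d x)) → ℂ) (J : Finset P) : ℝ :=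
  vonNeumannEntropy (reducedState (pureState ψ) J) (isHermitian_reducedState ψ J)

end Entropy

/-! ### Abstract error groups and stabiliser states -/

section Stabiliser

variable {n : Type*} [Fintype n] [DecidableEq n]

/-- A finite group of unitaries whose centre consists of scalars, whose quotient by the centre
is abelian of order the square of the dimension, and whose non-central elements are traceless. -/
structure IsAbstractErrorGroup (W : Subgroup (unitaryGroup n ℂ)) : Prop where
  finite : Finite W
  center_scalar : ∀ g : W, g ∈ Subgroup.center W →
    ∃ c : ℂ, ((g : unitaryGroup n ℂ) : Matrix n n ℂ) = c • (1 : Matrix n n ℂ)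
  quotient_comm : ∀ a b : W ⧸ Subgroup.center W, a * b = b * a
  quotient_card : Nat.card (W ⧸ Subgroup.center W) = Fintype.card n ^ 2
  trace_eq_zero : ∀ g : W, g ∉ Subgroup.center W →
    ((g : unitaryGroup n ℂ) : Matrix n n ℂ).trace = 0

/-- A unit vector that is a simultaneous eigenvector of a maximal abelian subgroup of `W`. -/
def IsStabiliserState (W : Subgroup (unitaryGroup n ℂ)) (ψ : n → ℂ) : Prop :=
  star ψ ⬝ᵥ ψ = 1 ∧
    ∃ G : Subgroup (unitaryGroup n ℂ),
      Maximal (fun K : Subgroup (unitaryGroup n ℂ) =>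
        K ≤ W ∧ ∀ g ∈ K, ∀ h ∈ K, g * h = h * g) G ∧
      ∀ g ∈ G, ∃ c : ℂ, (g : Matrix n n ℂ) *ᵥ ψ = c • ψ

variable {P : Type*} [Fintype P] [DecidableEq P] {d : P → ℕ}

/-- The tensor product of a family of local operators. -/
def tensorMatrix (g : ∀ x, Matrix (Fin (d x)) (Fin (d x)) ℂ) :
    Matrix (∀ x, Fin (d x)) (∀ x, Fin (d x)) ℂ :=
  Matrix.of fun i j => ∏ x, g x (i x) (j x)

theorem tensorMatrix_one :
    tensorMatrix (fun x => (1 : Matrix (Fin (d x)) (Fin (d x)) ℂ)) = 1 := by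
  ext i j
  by_cases h : i = j
  · subst h
    simp [tensorMatrix]
  · obtain ⟨x, hx⟩ := Function.ne_iff.mp h
    rw [Matrix.one_apply_ne h]
    exact Finset.prod_eq_zero (Finset.mem_univ x) (Matrix.one_apply_ne hx)

theorem tensorMatrix_mul (g h : ∀ x, Matrix (Fin (d x)) (Fin (d x)) ℂ) :
    tensorMatrix (fun x => g x * h x) = tensorMatrix g * tensorMatrix h := by
  ext i j
  simp only [tensorMatrix, Matrix.of_apply, Matrix.mul_apply]
  rw [Fintype.prod_sum]
  exact Finset.sum_congr rfl fun k _ => Finset.prod_mul_distrib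

theorem tensorMatrix_star (g : ∀ x, Matrix (Fin (d x)) (Fin (d x)) ℂ) :
    tensorMatrix (fun x => star (g x)) = star (tensorMatrix g) := by
  ext i j
  simp [tensorMatrix, Matrix.star_apply]

/-- The tensor product of local unitaries, as a group homomorphism. -/
def tensorHom : (∀ x, unitaryGroup (Fin (d x)) ℂ) →* unitaryGroup (∀ x, Fin (d x)) ℂ where
  toFun g := ⟨tensorMatrix fun x => (g x : Matrix (Fin (d x)) (Fin (d x)) ℂ), by
    rw [mem_unitaryGroup_iff, ← tensorMatrix_star, ← tensorMatrix_mul, ← tensorMatrix_one]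
    congr 1
    funext x
    exact mem_unitaryGroup_iff.mp (g x).2⟩
  map_one' := Subtype.ext tensorMatrix_one
  map_mul' g h := Subtype.ext (tensorMatrix_mul _ _)

/-- The tensor product group of all `⊗ₓ gₓ` with `gₓ` in the local group `W x`. -/
def tensorGroup (W : ∀ x, Subgroup (unitaryGroup (Fin (d x)) ℂ)) :
    Subgroup (unitaryGroup (∀ x, Fin (d x)) ℂ) :=
  (Subgroup.pi Set.univ W).map tensorHom

end Stabiliser

/-! ### Stabiliser-represented vectors -/

/-- The `N`-party entropy vectors of `(N + 1)`-party pure stabiliser states: the parties have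
arbitrary finite-dimensional Hilbert spaces `ℂ ^ d x` with local abstract error groups `W x`, and
the last party is left out of the vector. -/
def stabiliserEntropyVectors (N : ℕ) : Set (Finset (Fin N) → ℝ) :=
  {v | ∃ (d : Fin (N + 1) → ℕ) (W : ∀ x, Subgroup (unitaryGroup (Fin (d x)) ℂ))
      (ψ : (∀ x, Fin (d x)) → ℂ),
      (∀ x, IsAbstractErrorGroup (W x)) ∧ IsStabiliserState (tensorGroup W) ψ ∧
        ∀ J : Finset (Fin N), v J = reducedEntropy ψ (J.map Fin.castSuccEmb)}

/-- Membership in the closure of the convex cone generated by the stabiliser entropy vectors. -/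
def IsStabiliserRepresented {N : ℕ} (S : Finset (Fin N) → ℝ) : Prop :=
  S ∈ closure (PointedCone.hull ℝ (stabiliserEntropyVectors N) : Set (Finset (Fin N) → ℝ))

end StabCone

end

noncomputable section

namespace StabCone

/-! *Stabiliser states satisfy Ingleton.* An abstract error group is, up to phases, an orthogonal
basis of the local matrix algebra, so `|ψ⟩⟨ψ|` expands in tensor products `w` of local group
elements with coefficients the conjugates of `⟨w⟩`. Let `Γ` be the preimage of the maximal abelian
group `G` in the product of the local groups. Outside `Γ` the expectation vanishes: such a `w` fails
to commute with some member of `G`, but commutes with it up to a scalar (`expectation_eq_zero`).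
Tracing out parties kills every `w` that is non-central at one of them. Hence a reduced state is a
sum over a group, multiplicative up to a constant, so it is flat, and its entropy is a modular
function minus `log |⋂ N x|` for normal subgroups `N x` of `Γ`
(`exists_subgroups_of_isStabiliserState`). The modular part cancels in the Ingleton expression; what
remains is an inequality for orders of subgroups, true because the product of two normal subgroups
is a subgroup of known order (`ingleton_subgroups`). The inequalities survive conic combinations and
limits.

*Converse.* A poly-quantoid satisfying Ingleton obeys 70 linear inequalities in a space of dimension
15: ten `I(i:j) ≥ 0`, thirty `I(i:j|k) ≥ 0` and thirty Ingleton inequalities for the five parties. A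
verified double description computation (`Generates.cuts`, `cuts_baseCone`) shows that the cone they
cut out is generated by 46 vectors, of seven kinds up to permutations of the five parties. Each is a
positive multiple of the entropy vector of a stabiliser state, namely the uniform superposition of
the words of a group code, stabilised within Weyl–Heisenberg groups (`isStabiliserState_codeState`).
For linear codes of dimension `k` these entropies are, in units of `log p`, `rank K + rank Kᶜ - k`
(`rank_mem_hull`), and three small arrangements of subspaces, over the fields with 3, 5 and 2
elements, provide all the vectors. -/

/-! ### The double description method and its correctness. -/

/-- Entrywise `a * x + b * y`, the shorter list being padded with zeros. -/
def lincomb (a b : ℤ) : List ℤ → List ℤ → List ℤ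
  | [], ys => ys.map (b * ·)
  | x :: xs, [] => (x :: xs).map (a * ·)
  | x :: xs, y :: ys => (a * x + b * y) :: lincomb a b xs ys

/-- The sequence of real numbers with the given initial entries. -/
def seq (l : List ℤ) : ℕ → ℝ := fun i => (l.getD i 0 : ℤ)

theorem seq_lincomb (a b : ℤ) (xs ys : List ℤ) :
    seq (lincomb a b xs ys) = (a : ℝ) • seq xs + (b : ℝ) • seq ys := by
  have key : ∀ i, (lincomb a b xs ys).getD i 0 = a * xs.getD i 0 + b * ys.getD i 0 := by
    have map_getD : ∀ (c : ℤ) (l : List ℤ) (i : ℕ), (l.map (c * ·)).getD i 0 = c * l.getD i 0 := by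
      intro c l i
      simpa using List.getD_map (f := (c * ·)) (l := l) (d := 0) (n := i)
    induction xs, ys using lincomb.induct with
    | case1 ys =>
      intro i
      rw [lincomb, map_getD]
      simp
    | case2 x xs =>
      intro i
      rw [lincomb, map_getD]
      simp
    | case3 x xs y ys ih =>
      intro i
      cases i with
      | zero => simp [lincomb]
      | succ i => simpa [lincomb] using ih i
  funext i
  simp only [seq, key, Pi.add_apply, Pi.smul_apply, smul_eq_mul]
  push_cast
  ring

/-- A generator, together with the binary encoding of the set of its positive entries. -/
abbrev Ray := ℕ × List ℤ

/-- Drop each of the rays in the first list whose support contains that of another ray. -/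
def prune : List Ray → List Ray → List Ray
  | [], kept => kept
  | v :: todo, kept =>
    bif kept.any (fun u => (u.1 &&& v.1).beq u.1) || todo.any (fun u => (u.1 &&& v.1).beq u.1) then
      prune todo kept
    else prune todo (v :: kept)

/-- One step of the double description method: cut with the half-space of the sequences whose
`k`-th entry is non-negative. -/
def cut (k : ℕ) (R : List Ray) : List Ray :=
  let pos := R.filter fun r => decide (0 < r.2.getD k 0)
  let neg := R.filter fun r => decide (r.2.getD k 0 < 0)
  let zero := R.filter fun r => decide (r.2.getD k 0 = 0)
  prune (zero ++ (pos.map (fun r => (r.1 ||| 2 ^ k, r.2)) ++ pos.flatMap fun r => neg.map fun s =>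
    (r.1 ||| s.1, lincomb (r.2.getD k 0) (-s.2.getD k 0) s.2 r.2))) []

/-- Cut with the half-spaces of the entries `k`, …, `k + n - 1`. -/
def cuts : ℕ → ℕ → List Ray → List Ray
  | 0, _, R => R
  | n + 1, k, R => cuts n (k + 1) (cut k R)

/-- The cone generated by the sequences of a list of rays. -/
def rayCone (R : List Ray) : PointedCone ℝ (ℕ → ℝ) :=
  PointedCone.hull ℝ {y | ∃ r ∈ R, seq r.2 = y}

/-- The list `R` generates the cone of the sequences in `L` whose first `k` entries are
non-negative, and the first component of each of its rays encodes the support. -/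
structure Generates (L : Submodule ℝ (ℕ → ℝ)) (k : ℕ) (R : List Ray) : Prop where
  mem : ∀ r ∈ R, seq r.2 ∈ L
  nonneg : ∀ r ∈ R, ∀ i < k, 0 ≤ r.2.getD i 0
  supp : ∀ r ∈ R, ∀ i, (r.1.testBit i = true ↔ i < k ∧ 0 < r.2.getD i 0)
  pos : ∀ r ∈ R, ∃ i < k, 0 < r.2.getD i 0
  gen : ∀ x ∈ L, (∀ i < k, 0 ≤ x i) → x ∈ rayCone R

theorem seq_mem_rayCone {R : List Ray} {r : Ray} (h : r ∈ R) : seq r.2 ∈ rayCone R :=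
  Submodule.subset_span ⟨r, h, rfl⟩

theorem rayCone_le {R : List Ray} {C : PointedCone ℝ (ℕ → ℝ)} (h : ∀ r ∈ R, seq r.2 ∈ C) :
    rayCone R ≤ C :=
  Submodule.span_le.mpr (by rintro _ ⟨r, hr, rfl⟩; exact h r hr)

/-- The cone of the sequences whose `i`-th entry is non-negative. -/
def halfSpace (i : ℕ) : PointedCone ℝ (ℕ → ℝ) where
  carrier := {x | 0 ≤ x i}
  add_mem' {x y} (hx : 0 ≤ x i) (hy : 0 ≤ y i) := add_nonneg hx hy
  zero_mem' := le_refl (0 : ℝ)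
  smul_mem' c x (hx : 0 ≤ x i) := mul_nonneg c.2 hx

theorem Generates.seq_nonneg {L : Submodule ℝ (ℕ → ℝ)} {k : ℕ} {R : List Ray}
    (h : Generates L k R) {r : Ray} (hr : r ∈ R) {i : ℕ} (hi : i < k) : 0 ≤ seq r.2 i :=
  Int.cast_nonneg (h.nonneg r hr i hi)

/-- A ray `v` whose support contains that of another ray `u` is redundant: subtracting from `v` the
largest admissible multiple of `u` stays in the cone and makes an entry of `v` vanish, so the
difference cannot involve `v` itself. No adjacency test for pairs of rays is needed. -/
theorem Generates.erase {L : Submodule ℝ (ℕ → ℝ)} {k : ℕ} {R R' : List Ray} {u v : Ray}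
    (h : Generates L k R) (hsub : ∀ r ∈ R', r ∈ R) (hR : ∀ r ∈ R, r = v ∨ r ∈ R') (hv : v ∈ R)
    (hu : u ∈ R') (huv : u.1 &&& v.1 = u.1) : Generates L k R' where
  mem r hr := h.mem r (hsub r hr)
  nonneg r hr := h.nonneg r (hsub r hr)
  supp r hr := h.supp r (hsub r hr)
  pos r hr := h.pos r (hsub r hr)
  gen := by
    have hle : ∀ i < k, 0 < seq u.2 i → 0 < seq v.2 i := by
      intro i hi hui
      have h1 := (h.supp u (hsub u hu) i).mpr ⟨hi, Int.cast_pos.mp hui⟩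
      rw [← huv, Nat.testBit_land, Bool.and_eq_true] at h1
      exact Int.cast_pos.mpr ((h.supp v hv i).mp h1.2).2
    obtain ⟨i₀, hi₀, hpos⟩ := h.pos u (hsub u hu)
    -- The smallest ratio `v i / u i` over the support of `u` is the largest `t` for which `v - t •
    -- u` keeps its first `k` entries non-negative; at the minimiser `j` that entry is zero.
    obtain ⟨j, hj, hmin⟩ := Finset.exists_min_image
      ((Finset.range k).filter fun i => 0 < seq u.2 i) (fun i => seq v.2 i / seq u.2 i)
      ⟨i₀, Finset.mem_filter.mpr ⟨Finset.mem_range.mpr hi₀, Int.cast_pos.mpr hpos⟩⟩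
    simp only [Finset.mem_filter, Finset.mem_range] at hj hmin
    obtain ⟨hjk, hju⟩ := hj
    have hjv := hle j hjk hju
    set t := seq v.2 j / seq u.2 j with ht
    have ht0 : 0 ≤ t := by positivity
    have hw : seq v.2 - t • seq u.2 ∈ rayCone R := by
      refine h.gen _ (L.sub_mem (h.mem v hv) (L.smul_mem _ (h.mem u (hsub u hu)))) fun i hi => ?_
      rcases (h.seq_nonneg (hsub u hu) hi).eq_or_lt with h0 | h0
      · simpa [← h0] using h.seq_nonneg hv hi
      · have := (le_div_iff₀ h0).mp (hmin i ⟨hi, h0⟩)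
        simpa using this
    have hins : rayCone R ≤ PointedCone.hull ℝ (insert (seq v.2) {y | ∃ r ∈ R', seq r.2 = y}) :=
      rayCone_le fun r hr => Submodule.subset_span <| by
        rcases hR r hr with rfl | hr'
        · exact Set.mem_insert _ _
        · exact Set.mem_insert_of_mem _ ⟨r, hr', rfl⟩
    have hvmem : seq v.2 ∈ rayCone R' := by
      -- Split off the multiple `c` of `v` in `v - t • u`. The entry at `j` reads `0 = c * v j + z
      -- j` with `v j > 0` and `z j ≥ 0`, so `c = 0`.
      obtain ⟨c, z, hz, hcz⟩ := Submodule.mem_span_insert.mp (hins hw)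
      have hzj : 0 ≤ z j :=
        by
        have : rayCone R' ≤ halfSpace j :=
          rayCone_le fun r hr => show 0 ≤ seq r.2 j from h.seq_nonneg (hsub r hr) hjk
        exact this hz
      have hj0 : (seq v.2 - t • seq u.2) j = 0 := by
        simp [ht, div_mul_cancel₀ _ hju.ne']
      have hc0 : (c : ℝ) = 0 := by
        have h2 := congrFun hcz j
        rw [hj0] at h2
        have h3 : 0 = (c : ℝ) * seq v.2 j + z j := h2
        by_contra hne
        have : 0 < (c : ℝ) * seq v.2 j := mul_pos (lt_of_le_of_ne c.2 (Ne.symm hne)) hjv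
        linarith
      have h4 : seq v.2 = z + t • seq u.2 := by
        have : c • seq v.2 = 0 := by
          change (c : ℝ) • seq v.2 = 0
          rw [hc0, zero_smul]
        rw [this, zero_add] at hcz
        rw [← hcz, sub_add_cancel]
      rw [h4]
      exact add_mem hz ((rayCone R').smul_mem ht0 (seq_mem_rayCone hu))
    intro x hx hx0
    refine rayCone_le (C := rayCone R') (fun r hr => ?_) (h.gen x hx hx0)
    rcases hR r hr with rfl | hr'
    · exact hvmem
    · exact seq_mem_rayCone hr'

theorem Generates.of_mem_iff {L : Submodule ℝ (ℕ → ℝ)} {k : ℕ} {R R' : List Ray}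
    (h : Generates L k R) (hR : ∀ r, r ∈ R ↔ r ∈ R') : Generates L k R' where
  mem r hr := h.mem r ((hR r).mpr hr)
  nonneg r hr := h.nonneg r ((hR r).mpr hr)
  supp r hr := h.supp r ((hR r).mpr hr)
  pos r hr := h.pos r ((hR r).mpr hr)
  gen x hx hx0 := by simpa [rayCone, hR] using h.gen x hx hx0

theorem Generates.prune {L : Submodule ℝ (ℕ → ℝ)} {k : ℕ} (todo kept : List Ray)
    (h : Generates L k (todo ++ kept)) : Generates L k (prune todo kept) := by
  induction todo generalizing kept with
  | nil => simpa [StabCone.prune] using h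
  | cons v todo ih =>
    rw [StabCone.prune]
    cases hc : (kept.any (fun u => (u.1 &&& v.1).beq u.1) ||
        todo.any (fun u => (u.1 &&& v.1).beq u.1)) with
    | false =>
      refine ih _ (h.of_mem_iff fun r => ?_)
      simp only [List.cons_append, List.mem_cons, List.mem_append]
      tauto
    | true =>
      rw [Bool.or_eq_true, List.any_eq_true, List.any_eq_true] at hc
      have : ∃ u ∈ todo ++ kept, u.1 &&& v.1 = u.1 := by
        rcases hc with ⟨u, hu, h1⟩ | ⟨u, hu, h1⟩
        · exact ⟨u, List.mem_append_right _ hu, Nat.eq_of_beq_eq_true h1⟩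
        · exact ⟨u, List.mem_append_left _ hu, Nat.eq_of_beq_eq_true h1⟩
      obtain ⟨u, hu, huv⟩ := this
      exact ih _ (h.erase (v := v) (fun r hr => by simp_all) (fun r hr => by simp_all)
        (by simp) hu huv)

/-- Cutting a generated cone with a half-space: the generators on the positive side, those on
the boundary, and the combinations on the boundary of one on each side, generate the section. -/
theorem mem_of_cut {E : Type*} [AddCommGroup E] [Module ℝ E] (φ : E →ₗ[ℝ] ℝ)
    {sp sz sn : Set E} (hp : ∀ p ∈ sp, 0 < φ p) (hz : ∀ z ∈ sz, φ z = 0)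
    (hn : ∀ n ∈ sn, φ n < 0) {C : PointedCone ℝ E}
    (hpC : sp ⊆ C) (hzC : sz ⊆ C)
    (hC : ∀ p ∈ sp, ∀ n ∈ sn, φ p • n - φ n • p ∈ C) {x : E}
    (hx : x ∈ PointedCone.hull ℝ (sp ∪ sz ∪ sn)) (hx0 : 0 ≤ φ x) : x ∈ C := by
  -- The expression is bilinear in `(p, n)`, so membership extends from the generators to both
  -- hulls, one variable at a time.
  have hcomb : ∀ p ∈ PointedCone.hull ℝ sp, ∀ n ∈ PointedCone.hull ℝ sn,
      φ p • n - φ n • p ∈ C := by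
    intro p hp n hn
    induction hp using Submodule.span_induction with
    | mem p hp =>
      induction hn using Submodule.span_induction with
      | mem n hn => exact hC p hp n hn
      | zero => simp
      | add y z _ _ hy hz =>
        have := add_mem hy hz
        rw [map_add]
        convert this using 1
        module
      | smul c y _ hy =>
        have := C.smul_mem c.2 hy
        change φ p • ((c : ℝ) • y) - φ ((c : ℝ) • y) • p ∈ C
        change (c : ℝ) • (φ p • y - φ y • p) ∈ C at this
        rw [map_smul]
        convert this using 1
        simp only [smul_eq_mul]
        module
    | zero => simp
    | add y z _ _ hy hz =>
      have := add_mem hy hz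
      rw [map_add]
      convert this using 1
      module
    | smul c y _ hy =>
      have := C.smul_mem c.2 hy
      change φ ((c : ℝ) • y) • n - φ n • ((c : ℝ) • y) ∈ C
      change (c : ℝ) • (φ y • n - φ n • y) ∈ C at this
      rw [map_smul]
      convert this using 1
      simp only [smul_eq_mul]
      module
  have hpos : ∀ (s : Set E) (ψ : E →ₗ[ℝ] ℝ), (∀ p ∈ s, 0 < ψ p) →
      ∀ p ∈ PointedCone.hull ℝ s, p = 0 ∨ 0 < ψ p := by
    intro s ψ hs p hp
    induction hp using Submodule.span_induction with
    | mem p hp => exact Or.inr (hs p hp)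
    | zero => exact Or.inl rfl
    | add y z _ _ hy hz =>
      rcases hy with rfl | hy
      · simpa using hz
      · rcases hz with rfl | hz
        · simpa using Or.inr hy
        · exact Or.inr (by rw [map_add]; exact add_pos hy hz)
    | smul c y _ hy =>
      change (c : ℝ) • y = 0 ∨ 0 < ψ ((c : ℝ) • y)
      rcases hy with rfl | hy
      · simp
      · rcases c.2.eq_or_lt with h | h
        · exact Or.inl (by rw [← h, zero_smul])
        · exact Or.inr (by rw [map_smul]; exact mul_pos h hy)
  rw [PointedCone.hull, Submodule.span_union, Submodule.span_union] at hx
  obtain ⟨y, hy, n, hn', rfl⟩ := Submodule.mem_sup.mp hx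
  obtain ⟨p, hp', z, hz', rfl⟩ := Submodule.mem_sup.mp hy
  have hzC' : z ∈ C := Submodule.span_le.mpr hzC hz'
  have hpC' : p ∈ C := Submodule.span_le.mpr hpC hp'
  have hφz : φ z = 0 := by
    clear hx hx0 hzC' hy
    induction hz' using Submodule.span_induction with
    | mem z h => exact hz z h
    | zero => exact map_zero φ
    | add y z _ _ hy hz => rw [map_add, hy, hz, add_zero]
    | smul c y _ hy => exact (map_smul φ (c : ℝ) y).trans (by rw [hy, smul_zero])
  rw [map_add, map_add, hφz, add_zero] at hx0
  rcases hpos sn (-φ) (fun n h => neg_pos.mpr (hn n h)) n hn' with rfl | hn0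
  · simpa using add_mem hpC' hzC'
  rw [LinearMap.neg_apply] at hn0
  rcases hpos sp φ hp p hp' with rfl | hp0
  · rw [map_zero] at hx0
    linarith
  -- For `x = p + z + n` this uses `p + n = (φ p)⁻¹ • (φ p • n - φ n • p) + (φ x / φ p) • p`, where
  -- both coefficients are non-negative.
  have h1 := C.smul_mem (inv_nonneg.mpr hp0.le) (hcomb p hp' n hn')
  have h2 := C.smul_mem (div_nonneg hx0 hp0.le) hpC'
  have h3 := add_mem (add_mem h1 h2) hzC'
  convert h3 using 1
  match_scalars <;> field_simp
  ring

theorem Generates.cut {L : Submodule ℝ (ℕ → ℝ)} {k : ℕ} {R : List Ray}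
    (h : Generates L k R) : Generates L (k + 1) (cut k R) := by
  refine Generates.prune _ _ ?_
  rw [List.append_nil]
  have hcomb : ∀ r s : Ray, ∀ i, (lincomb (r.2.getD k 0) (-s.2.getD k 0) s.2 r.2).getD i 0 =
      r.2.getD k 0 * s.2.getD i 0 + -s.2.getD k 0 * r.2.getD i 0 := fun r s i => by
    have := congrFun (seq_lincomb (r.2.getD k 0) (-s.2.getD k 0) s.2 r.2) i
    simp only [seq, Pi.add_apply, Pi.smul_apply, smul_eq_mul] at this
    exact_mod_cast this
  have key : ∀ t : Ray, t ∈ (R.filter (fun r => decide (r.2.getD k 0 = 0))) ++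
      ((R.filter (fun r => decide (0 < r.2.getD k 0))).map (fun r => (r.1 ||| 2 ^ k, r.2)) ++
      (R.filter (fun r => decide (0 < r.2.getD k 0))).flatMap fun r =>
        (R.filter (fun r => decide (r.2.getD k 0 < 0))).map fun s =>
        (r.1 ||| s.1, lincomb (r.2.getD k 0) (-s.2.getD k 0) s.2 r.2)) ↔
      (t ∈ R ∧ t.2.getD k 0 = 0) ∨ (∃ r ∈ R, 0 < r.2.getD k 0 ∧ t = (r.1 ||| 2 ^ k, r.2)) ∨
      ∃ r ∈ R, 0 < r.2.getD k 0 ∧ ∃ s ∈ R, s.2.getD k 0 < 0 ∧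
        t = (r.1 ||| s.1, lincomb (r.2.getD k 0) (-s.2.getD k 0) s.2 r.2) := by
    intro t
    simp only [List.mem_append, List.mem_filter, List.mem_map, List.mem_flatMap, decide_eq_true_eq,
      and_assoc, eq_comm (a := t)]
  constructor
  · intro t ht
    rcases (key t).mp ht with ⟨h1, -⟩ | ⟨r, hr, -, rfl⟩ | ⟨r, hr, -, s, hs, -, rfl⟩
    · exact h.mem t h1
    · exact h.mem r hr
    · rw [seq_lincomb]
      exact L.add_mem (L.smul_mem _ (h.mem s hs)) (L.smul_mem _ (h.mem r hr))
  · intro t ht i hi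
    rcases (key t).mp ht with ⟨h1, h0⟩ | ⟨r, hr, h0, rfl⟩ | ⟨r, hr, h0, s, hs, h0', rfl⟩
    · rcases Nat.lt_succ_iff_lt_or_eq.mp hi with hi | rfl
      · exact h.nonneg t h1 i hi
      · exact h0.ge
    · rcases Nat.lt_succ_iff_lt_or_eq.mp hi with hi | rfl
      · exact h.nonneg r hr i hi
      · exact h0.le
    · rw [hcomb]
      rcases Nat.lt_succ_iff_lt_or_eq.mp hi with hi | rfl
      · exact add_nonneg (mul_nonneg h0.le (h.nonneg s hs i hi))
          (mul_nonneg (by lia) (h.nonneg r hr i hi))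
      · lia
  · intro t ht i
    rcases (key t).mp ht with ⟨h1, h0⟩ | ⟨r, hr, h0, rfl⟩ | ⟨r, hr, h0, s, hs, h0', rfl⟩
    · rw [h.supp t h1]
      rcases eq_or_ne i k with rfl | hik
      · simp [-List.getD_eq_getElem?_getD, h0]
      · lia
    · rw [Nat.testBit_lor, Bool.or_eq_true, h.supp r hr]
      rcases eq_or_ne i k with rfl | hik
      · simp [-List.getD_eq_getElem?_getD, h0]
      · rw [Nat.testBit_two_pow_of_ne hik.symm]
        lia
    -- Both coefficients of the combination are positive: below `k` its support is the union of the
    -- two supports. At `k` the two terms cancel, so bit `k` stays unset.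
    · rw [Nat.testBit_lor, Bool.or_eq_true, h.supp r hr, h.supp s hs, hcomb]
      rcases lt_trichotomy i k with hik | rfl | hik
      · have h1 := mul_nonneg h0.le (h.nonneg s hs i hik)
        have h2 := mul_nonneg (neg_nonneg.mpr h0'.le) (h.nonneg r hr i hik)
        have h3 := (mul_pos_iff_of_pos_left (b := s.2.getD i 0) h0)
        have h4 := (mul_pos_iff_of_pos_left (b := r.2.getD i 0) (neg_pos.mpr h0'))
        lia
      · constructor
        · lia
        · rintro ⟨-, h5⟩
          rw [neg_mul, mul_comm (s.2.getD i 0)] at h5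
          lia
      · lia
  · intro t ht
    rcases (key t).mp ht with ⟨h1, h0⟩ | ⟨r, hr, h0, rfl⟩ | ⟨r, hr, h0, s, hs, h0', rfl⟩
    · obtain ⟨i, hi, hp⟩ := h.pos t h1
      exact ⟨i, hi.trans (Nat.lt_succ_self k), hp⟩
    · exact ⟨k, Nat.lt_succ_self k, h0⟩
    · obtain ⟨i, hi, hp⟩ := h.pos r hr
      refine ⟨i, hi.trans (Nat.lt_succ_self k), ?_⟩
      rw [hcomb]
      exact add_pos_of_nonneg_of_pos (mul_nonneg h0.le (h.nonneg s hs i hi))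
        (mul_pos (neg_pos.mpr h0') hp)
  · intro x hx hx0
    refine mem_of_cut (LinearMap.proj k)
      (sp := {y | ∃ r ∈ R, 0 < r.2.getD k 0 ∧ seq r.2 = y})
      (sz := {y | ∃ r ∈ R, r.2.getD k 0 = 0 ∧ seq r.2 = y})
      (sn := {y | ∃ r ∈ R, r.2.getD k 0 < 0 ∧ seq r.2 = y}) ?_ ?_ ?_ ?_ ?_ ?_ ?_
      (hx0 k (Nat.lt_succ_self k))
    · rintro _ ⟨r, hr, h0, rfl⟩
      exact Int.cast_pos.mpr h0
    · rintro _ ⟨r, hr, h0, rfl⟩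
      exact Int.cast_eq_zero.mpr h0
    · rintro _ ⟨r, hr, h0, rfl⟩
      exact Int.cast_lt_zero.mpr h0
    · rintro _ ⟨r, hr, h0, rfl⟩
      exact seq_mem_rayCone (r := (r.1 ||| 2 ^ k, r.2))
        ((key _).mpr (Or.inr (Or.inl ⟨r, hr, h0, rfl⟩)))
    · rintro _ ⟨r, hr, h0, rfl⟩
      exact seq_mem_rayCone ((key _).mpr (Or.inl ⟨hr, h0⟩))
    · rintro _ ⟨r, hr, h0, rfl⟩ _ ⟨s, hs, h0', rfl⟩
      have := seq_mem_rayCone ((key _).mpr (Or.inr (Or.inr ⟨r, hr, h0, s, hs, h0', rfl⟩)))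
      rw [seq_lincomb, Int.cast_neg, neg_smul, ← sub_eq_add_neg] at this
      exact this
    · refine rayCone_le (fun r hr => Submodule.subset_span ?_)
        (h.gen x hx fun i hi => hx0 i (hi.trans (Nat.lt_succ_self k)))
      rcases lt_trichotomy (r.2.getD k 0) 0 with h0 | h0 | h0
      · exact Or.inr ⟨r, hr, h0, rfl⟩
      · exact Or.inl (Or.inr ⟨r, hr, h0, rfl⟩)
      · exact Or.inl (Or.inl ⟨r, hr, h0, rfl⟩)

theorem Generates.cuts {L : Submodule ℝ (ℕ → ℝ)} (n k : ℕ) {R : List Ray}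
    (h : Generates L k R) : Generates L (k + n) (cuts n k R) := by
  induction n generalizing k R with
  | zero => exact h
  | succ n ih =>
    have := ih (k + 1) h.cut
    rwa [Nat.add_right_comm, Nat.add_assoc] at this

/-! ### Entropies of flat states -/

/-- Every eigenvalue is `0` or `c`, and in both cases `-μ log μ = μ * (-log c)`; the eigenvalues sum
to the trace `1`. -/
theorem vonNeumannEntropy_of_mul_self {n : Type*} [Fintype n] [DecidableEq n] {ρ : Matrix n n ℂ}
    (hρ : ρ.IsHermitian) {c : ℝ} (h : ρ * ρ = (c : ℂ) • ρ) (htr : ρ.trace = 1) :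
    vonNeumannEntropy ρ hρ = -Real.log c := by
  have hsum : ∑ i, hρ.eigenvalues i = 1 := by
    have := hρ.trace_eq_sum_eigenvalues
    rw [htr] at this
    have h2 : ((∑ i, hρ.eigenvalues i : ℝ) : ℂ) = ((1 : ℝ) : ℂ) := by simpa using this.symm
    exact Complex.ofReal_inj.mp h2
  have hev : ∀ i, Real.negMulLog (hρ.eigenvalues i) = hρ.eigenvalues i * -Real.log c := by
    intro i
    set μ := hρ.eigenvalues i with hμ
    have h1 : ρ *ᵥ (hρ.eigenvectorBasis i).ofLp = (μ : ℂ) • (hρ.eigenvectorBasis i).ofLp :=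
      hρ.mulVec_eigenvectorBasis i
    have h2 : (μ : ℂ) • (μ : ℂ) • (hρ.eigenvectorBasis i).ofLp =
        (c : ℂ) • (μ : ℂ) • (hρ.eigenvectorBasis i).ofLp := by
      calc _ = (ρ * ρ) *ᵥ (hρ.eigenvectorBasis i).ofLp := by rw [← mulVec_mulVec, h1, mulVec_smul, h1]
        _ = _ := by rw [h, smul_mulVec, h1]
    have hne : (hρ.eigenvectorBasis i).ofLp ≠ 0 := by
      have := hρ.eigenvectorBasis.orthonormal.ne_zero i
      simpa using this
    rw [smul_smul, smul_smul] at h2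
    have h3 := smul_left_injective ℂ hne h2
    have h4 : μ * μ = c * μ := by exact_mod_cast h3
    rcases mul_eq_mul_right_iff.mp h4 with h5 | h5
    · rw [← h5, Real.negMulLog]
      ring
    · rw [h5]
      simp
  rw [vonNeumannEntropy, Finset.sum_congr rfl fun i _ => hev i, ← Finset.sum_mul, hsum, one_mul]

section Reduced

variable {P : Type*} [Fintype P] [DecidableEq P] {d : P → ℕ}

theorem sum_glue (J : Finset P) (f : (∀ x, Fin (d x)) → ℂ) :
    ∑ i, ∑ k, f (glue J i k) = ∑ i, f i := by
  rw [← Fintype.sum_prod_type', ← (Equiv.piEquivPiSubtypeProd (· ∈ J) fun x => Fin (d x)).symm.sum_comp]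
  rfl

theorem trace_reducedState (ψ : (∀ x, Fin (d x)) → ℂ) (J : Finset P) :
    (reducedState (pureState ψ) J).trace = star ψ ⬝ᵥ ψ := by
  rw [dotProduct, ← sum_glue J]
  simp [trace, reducedState, pureState, vecMulVec_apply, mul_comm]

/-- Both purities are the same fourfold sum of products of amplitudes. For flat states the purity
determines the entropy, so complementary entropies agree without a Schmidt decomposition. -/
theorem trace_reducedState_mul_self_compl (ψ : (∀ x, Fin (d x)) → ℂ) (J : Finset P) :
    (reducedState (pureState ψ) Jᶜ * reducedState (pureState ψ) Jᶜ).trace =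
      (reducedState (pureState ψ) J * reducedState (pureState ψ) J).trace := by
  let e₁ : (∀ x : {x // x ∈ Jᶜ}, Fin (d x)) ≃ (∀ x : {x // x ∉ J}, Fin (d x)) :=
    { toFun := fun f x => f ⟨x, Finset.mem_compl.mpr x.2⟩
      invFun := fun f x => f ⟨x, Finset.mem_compl.mp x.2⟩
      left_inv := fun _ => rfl
      right_inv := fun _ => rfl }
  let e₂ : (∀ x : {x // x ∉ Jᶜ}, Fin (d x)) ≃ (∀ x : {x // x ∈ J}, Fin (d x)) :=
    { toFun := fun f x => f ⟨x, fun h => Finset.mem_compl.mp h x.2⟩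
      invFun := fun f x => f ⟨x, not_not.mp fun h => x.2 (Finset.mem_compl.mpr h)⟩
      left_inv := fun _ => rfl
      right_inv := fun _ => rfl }
  have hglue : ∀ i k, glue Jᶜ i k = glue J (e₂ k) (e₁ i) := by
    intro i k
    funext x
    by_cases hx : x ∈ J
    · simp [glue, hx, e₂]
    · simp [glue, hx, e₁]
  let F : (∀ x : {x // x ∉ J}, Fin (d x)) → (∀ x : {x // x ∉ J}, Fin (d x)) →
      (∀ x : {x // x ∈ J}, Fin (d x)) → (∀ x : {x // x ∈ J}, Fin (d x)) → ℂ := fun i j k l =>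
    ψ (glue J k i) * star (ψ (glue J k j)) * (ψ (glue J l j) * star (ψ (glue J l i)))
  calc _ = ∑ i, ∑ j, ∑ k, ∑ l, F (e₁ i) (e₁ j) (e₂ k) (e₂ l) := by
        simp only [trace, diag, mul_apply, reducedState, of_apply, hglue, pureState,
          vecMulVec_apply, Finset.sum_mul_sum]
        rfl
    _ = ∑ i, ∑ j, ∑ k, ∑ l, F i j k l :=
      Fintype.sum_equiv e₁ _ _ fun i => Fintype.sum_equiv e₁ _ _ fun j =>
        Fintype.sum_equiv e₂ _ _ fun k => Fintype.sum_equiv e₂ _ _ fun l => rfl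
    _ = ∑ k, ∑ l, ∑ i, ∑ j, F i j k l := by
      have := Finset.sum_comm (s := Finset.univ) (t := Finset.univ)
        (f := fun p : _ × _ => fun q : _ × _ => F p.1 p.2 q.1 q.2)
      simpa only [Fintype.sum_prod_type] using this
    _ = _ := by
      simp only [trace, diag, mul_apply, reducedState, of_apply, pureState,
        vecMulVec_apply, Finset.sum_mul_sum]
      refine Finset.sum_congr rfl fun k _ => Finset.sum_congr rfl fun l _ =>
        Finset.sum_congr rfl fun i _ => Finset.sum_congr rfl fun j _ => ?_
      simp only [F, Pi.star_apply]
      ring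

theorem reducedEntropy_of_mul_self {ψ : (∀ x, Fin (d x)) → ℂ} (hψ : star ψ ⬝ᵥ ψ = 1)
    {J : Finset P} {c : ℝ}
    (h : reducedState (pureState ψ) J * reducedState (pureState ψ) J =
      (c : ℂ) • reducedState (pureState ψ) J) : reducedEntropy ψ J = -Real.log c :=
  vonNeumannEntropy_of_mul_self _ h ((trace_reducedState ψ J).trans hψ)

theorem reducedEntropy_compl_of_mul_self {ψ : (∀ x, Fin (d x)) → ℂ} (hψ : star ψ ⬝ᵥ ψ = 1)
    {J : Finset P} {c c' : ℝ}
    (h : reducedState (pureState ψ) J * reducedState (pureState ψ) J =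
      (c : ℂ) • reducedState (pureState ψ) J)
    (h' : reducedState (pureState ψ) Jᶜ * reducedState (pureState ψ) Jᶜ =
      (c' : ℂ) • reducedState (pureState ψ) Jᶜ) : reducedEntropy ψ Jᶜ = reducedEntropy ψ J := by
  have := trace_reducedState_mul_self_compl ψ J
  rw [h, h', trace_smul, trace_smul, trace_reducedState, trace_reducedState, hψ, smul_eq_mul,
    smul_eq_mul, mul_one, mul_one] at this
  rw [reducedEntropy_of_mul_self hψ h, reducedEntropy_of_mul_self hψ h', Complex.ofReal_inj.mp this]

end Reduced

/-! ### Completeness of abstract error groups -/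

section ErrorGroup

variable {n : Type*} [Fintype n] [DecidableEq n]

theorem IsAbstractErrorGroup.trace_star_mul {W : Subgroup (unitaryGroup n ℂ)}
    (hW : IsAbstractErrorGroup W) {g h : W}
    (hgh : (g : W ⧸ Subgroup.center W) ≠ (h : W ⧸ Subgroup.center W)) :
    (star (g : Matrix n n ℂ) * (h : Matrix n n ℂ)).trace = 0 :=
  hW.trace_eq_zero (g⁻¹ * h) fun hmem => hgh (QuotientGroup.eq.mpr hmem)

theorem star_mul_self_coe {W : Subgroup (unitaryGroup n ℂ)} (g : W) :
    star (g : Matrix n n ℂ) * (g : Matrix n n ℂ) = 1 :=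
  mem_unitaryGroup_iff'.mp g.1.2

/-- Completeness of the operator basis. Coset representatives form the rows of a matrix;
tracelessness makes the rows orthogonal, and the order of the quotient makes the matrix square, so
its columns are orthogonal too. -/
theorem IsAbstractErrorGroup.sum_quotient {W : Subgroup (unitaryGroup n ℂ)}
    (hW : IsAbstractErrorGroup W) [Fintype (W ⧸ Subgroup.center W)] [Nonempty n] (i j k l : n) :
    ∑ q : W ⧸ Subgroup.center W, star ((q.out : Matrix n n ℂ) i j) * (q.out : Matrix n n ℂ) k l =
      if i = k ∧ j = l then (Fintype.card n : ℂ) else 0 := by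
  classical
  have hn : (Fintype.card n : ℂ) ≠ 0 := Nat.cast_ne_zero.mpr Fintype.card_ne_zero
  let U : Matrix (W ⧸ Subgroup.center W) (n × n) ℂ :=
    of fun q p => (q.out : Matrix n n ℂ) p.1 p.2
  have hU : U * ((Fintype.card n : ℂ)⁻¹ • Uᴴ) = 1 := by
    ext q r
    have h1 : (U * Uᴴ) q r = (star (r.out : Matrix n n ℂ) * (q.out : Matrix n n ℂ)).trace := by
      simp only [U, mul_apply, conjTranspose_apply, of_apply, trace, diag, star_apply,
        Fintype.sum_prod_type]
      rw [Finset.sum_comm]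
      exact Finset.sum_congr rfl fun a _ => Finset.sum_congr rfl fun b _ => mul_comm _ _
    rw [Matrix.mul_smul, Matrix.smul_apply, h1]
    by_cases hqr : q = r
    · subst hqr
      rw [star_mul_self_coe, trace_one, one_apply_eq, smul_eq_mul, inv_mul_cancel₀ hn]
    · rw [one_apply_ne hqr, hW.trace_star_mul, smul_zero]
      rw [QuotientGroup.out_eq', QuotientGroup.out_eq']
      exact fun h => hqr h.symm
  have hcard : Fintype.card (W ⧸ Subgroup.center W) = Fintype.card (n × n) := by
    rw [← Nat.card_eq_fintype_card, hW.quotient_card, Fintype.card_prod, sq]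
  rw [Matrix.mul_eq_one_comm_of_card_eq _ _ _ hcard] at hU
  have h2 := congrFun (congrFun hU (i, j)) (k, l)
  rw [Matrix.smul_mul, Matrix.smul_apply, smul_eq_mul, inv_mul_eq_iff_eq_mul₀ hn, one_apply] at h2
  simpa [U, mul_apply, Prod.ext_iff] using h2

/-- The same relation summed over the whole group: a central phase cancels against its conjugate, so
every coset contributes its representative's term once for each element of the centre. -/
theorem IsAbstractErrorGroup.exists_sum {W : Subgroup (unitaryGroup n ℂ)}
    (hW : IsAbstractErrorGroup W) [Fintype W] [Nonempty n] :
    ∃ c : ℝ, 0 < c ∧ ∀ i j k l, ∑ w : W, star ((w : Matrix n n ℂ) i j) * (w : Matrix n n ℂ) k l =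
      if i = k ∧ j = l then (c : ℂ) else 0 := by
  classical
  refine ⟨Nat.card (Subgroup.center W) * Fintype.card n,
    mul_pos (Nat.cast_pos.mpr Nat.card_pos) (Nat.cast_pos.mpr Fintype.card_pos), fun i j k l => ?_⟩
  have hout : ∀ w : W, star ((w : Matrix n n ℂ) i j) * (w : Matrix n n ℂ) k l =
      star (((w : W ⧸ Subgroup.center W).out : Matrix n n ℂ) i j) *
        ((w : W ⧸ Subgroup.center W).out : Matrix n n ℂ) k l := by
    intro w
    obtain ⟨z, hz⟩ := QuotientGroup.mk_out_eq_mul (Subgroup.center W) w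
    obtain ⟨c, hc⟩ := hW.center_scalar z.1 z.2
    have hcc : star c * c = 1 := by
      have := star_mul_self_coe z.1
      rw [hc, star_smul, star_one, smul_mul_smul_comm, one_mul] at this
      simpa using congrFun (congrFun this i) i
    rw [hz]
    have : ((w * z.1 : W) : Matrix n n ℂ) = c • (w : Matrix n n ℂ) := by
      change (w : Matrix n n ℂ) * (z.1 : Matrix n n ℂ) = _
      rw [hc, Matrix.mul_smul, mul_one]
    rw [this, Matrix.smul_apply, Matrix.smul_apply, smul_eq_mul, smul_eq_mul, star_mul']
    linear_combination (-(star ((w : Matrix n n ℂ) i j) * (w : Matrix n n ℂ) k l)) * hcc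
  rw [Finset.sum_congr rfl fun w _ => hout w,
    Finset.sum_comp (fun q : W ⧸ Subgroup.center W =>
      star ((q.out : Matrix n n ℂ) i j) * (q.out : Matrix n n ℂ) k l) (fun w : W => (w : W ⧸ Subgroup.center W))]
  have himage : Finset.univ.image (fun w : W => (w : W ⧸ Subgroup.center W)) = Finset.univ :=
    Finset.image_univ_of_surjective QuotientGroup.mk_surjective
  have hfib : ∀ q : W ⧸ Subgroup.center W,
      ({w : W | (w : W ⧸ Subgroup.center W) = q} : Finset W).card =
        Nat.card (Subgroup.center W) := by
    intro q
    have := QuotientGroup.card_preimage_mk (Subgroup.center W) {q}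
    rw [Nat.card_unique (α := ({q} : Set (W ⧸ Subgroup.center W))), mul_one] at this
    rw [← this]
    exact (Nat.subtype_card _ fun w => by simp).symm
  rw [himage, Finset.sum_congr rfl fun q _ => by rw [hfib q], ← Finset.smul_sum,
    hW.sum_quotient]
  split_ifs <;> simp

end ErrorGroup

/-! ### Tensor products of local error groups. -/

section Tensor

variable {P : Type*} [Fintype P] [DecidableEq P] {d : P → ℕ}
  {W : ∀ x, Subgroup (unitaryGroup (Fin (d x)) ℂ)}

/-- The tensor product of elements of the local groups. -/
def localHom (W : ∀ x, Subgroup (unitaryGroup (Fin (d x)) ℂ)) :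
    (∀ x, W x) →* unitaryGroup (∀ x, Fin (d x)) ℂ :=
  tensorHom.comp (MonoidHom.mk' (fun w x => (w x).1) fun _ _ => rfl)

/-- The matrix of a tensor product of elements of the local groups. -/
def localMatrix (w : ∀ x, W x) : Matrix (∀ x, Fin (d x)) (∀ x, Fin (d x)) ℂ :=
  tensorMatrix fun x => ((w x).1 : Matrix (Fin (d x)) (Fin (d x)) ℂ)

theorem coe_localHom (w : ∀ x, W x) :
    (localHom W w : Matrix (∀ x, Fin (d x)) (∀ x, Fin (d x)) ℂ) = localMatrix w := rfl

theorem mem_tensorGroup {g : unitaryGroup (∀ x, Fin (d x)) ℂ} :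
    g ∈ tensorGroup W ↔ ∃ w : ∀ x, W x, localHom W w = g := by
  constructor
  · rintro ⟨w, hw, rfl⟩
    exact ⟨fun x => ⟨w x, hw x (Set.mem_univ x)⟩, rfl⟩
  · rintro ⟨w, rfl⟩
    exact ⟨fun x => (w x).1, fun x _ => (w x).2, rfl⟩

theorem localMatrix_mul (v w : ∀ x, W x) :
    localMatrix (v * w) = localMatrix v * localMatrix w :=
  tensorMatrix_mul _ _

theorem localMatrix_inv (w : ∀ x, W x) : localMatrix w⁻¹ = star (localMatrix w) :=
  tensorMatrix_star _

omit [DecidableEq P] in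
theorem localMatrix_smul {v w : ∀ x, W x} {c : P → ℂ}
    (h : ∀ x, ((v x).1 : Matrix (Fin (d x)) (Fin (d x)) ℂ) = c x • ((w x).1 : Matrix _ _ ℂ)) :
    localMatrix v = (∏ x, c x) • localMatrix w := by
  ext i j
  simp [localMatrix, tensorMatrix, h, Finset.prod_mul_distrib]

theorem sum_localMatrix [∀ x, Fintype (W x)] {c : P → ℝ}
    (hc : ∀ x i j k l, ∑ w : W x, star ((w : Matrix (Fin (d x)) (Fin (d x)) ℂ) i j) *
      (w : Matrix (Fin (d x)) (Fin (d x)) ℂ) k l =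
      if i = k ∧ j = l then (c x : ℂ) else 0) (i j k l : ∀ x, Fin (d x)) :
    ∑ w : ∀ x, W x, star (localMatrix w i j) * localMatrix w k l =
      if i = k ∧ j = l then ((∏ x, c x : ℝ) : ℂ) else 0 := by
  have h1 : ∀ w : ∀ x, W x, star (localMatrix w i j) * localMatrix w k l =
      ∏ x, (star ((w x : Matrix (Fin (d x)) (Fin (d x)) ℂ) (i x) (j x)) *
        (w x : Matrix (Fin (d x)) (Fin (d x)) ℂ) (k x) (l x)) := by
    intro w
    simp [localMatrix, tensorMatrix, Finset.prod_mul_distrib, -mul_eq_mul_left_iff]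
  rw [Finset.sum_congr rfl fun w _ => h1 w]
  refine (Fintype.prod_sum fun x (g : W x) => star ((g : Matrix (Fin (d x)) (Fin (d x)) ℂ) (i x)
    (j x)) * (g : Matrix (Fin (d x)) (Fin (d x)) ℂ) (k x) (l x)).symm.trans ?_
  simp only [hc]
  split_ifs with h
  · obtain ⟨rfl, rfl⟩ := h
    simp
  · rw [not_and_or, ← ne_eq, ← ne_eq, Function.ne_iff, Function.ne_iff] at h
    rcases h with ⟨x, hx⟩ | ⟨x, hx⟩
    · exact Finset.prod_eq_zero (Finset.mem_univ x) (if_neg fun h => hx h.1)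
    · exact Finset.prod_eq_zero (Finset.mem_univ x) (if_neg fun h => hx h.2)

end Tensor

/-! ### Expectation values of local operators in a stabiliser state. -/

section Stabilised

variable {P : Type*} [Fintype P] [DecidableEq P] {d : P → ℕ}
  {W : ∀ x, Subgroup (unitaryGroup (Fin (d x)) ℂ)}

/-- The expectation value `⟨ψ, w ψ⟩` of a product `w` of local unitaries. -/
def expectation (ψ : (∀ x, Fin (d x)) → ℂ) (w : ∀ x, W x) : ℂ :=
  star ψ ⬝ᵥ (localMatrix w *ᵥ ψ)

theorem star_dotProduct_localMatrix_mulVec (w : ∀ x, W x) (φ ψ : (∀ x, Fin (d x)) → ℂ) :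
    star φ ⬝ᵥ (localMatrix w *ᵥ ψ) = star (localMatrix w⁻¹ *ᵥ φ) ⬝ᵥ ψ := by
  rw [localMatrix_inv, star_mulVec, ← star_eq_conjTranspose, star_star, dotProduct_mulVec]

theorem expectation_inv (ψ : (∀ x, Fin (d x)) → ℂ) (w : ∀ x, W x) :
    expectation ψ w⁻¹ = star (expectation ψ w) := by
  rw [expectation, expectation, star_dotProduct_localMatrix_mulVec, inv_inv]
  exact star_dotProduct _ _

/-- The expansion of `|ψ⟩⟨ψ|` in the overcomplete family of local operators, each basis operator
being repeated with different phases; `c` absorbs the multiplicity. -/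
theorem smul_pureState_eq_sum (ψ : (∀ x, Fin (d x)) → ℂ) {c : ℝ} [∀ x, Fintype (W x)]
    (hc : ∀ i j k l : ∀ x, Fin (d x), ∑ w : ∀ x, W x, star (localMatrix w i j) * localMatrix w k l =
      if i = k ∧ j = l then (c : ℂ) else 0) :
    (c : ℂ) • pureState ψ = ∑ w : ∀ x, W x, star (expectation ψ w) • localMatrix w := by
  ext k l
  rw [Matrix.sum_apply]
  have h1 : ∀ w : ∀ x, W x, (star (expectation ψ w) • localMatrix w) k l =
      ∑ i, ∑ j, ψ i * star (ψ j) * (star (localMatrix w i j) * localMatrix w k l) := by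
    intro w
    simp only [expectation, dotProduct, mulVec, Matrix.smul_apply, smul_eq_mul, star_sum,
      Finset.mul_sum, Finset.sum_mul, star_mul', Pi.star_apply, star_star]
    exact Finset.sum_congr rfl fun i _ => Finset.sum_congr rfl fun j _ => by ring
  rw [Finset.sum_congr rfl fun w _ => h1 w, Finset.sum_comm]
  have h2 : ∀ i j, ∑ w : ∀ x, W x, ψ i * star (ψ j) * (star (localMatrix w i j) * localMatrix w k l)
      = if i = k ∧ j = l then ψ i * star (ψ j) * c else 0 := by
    intro i j
    rw [← Finset.mul_sum, hc, mul_ite, mul_zero]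
  simp only [Finset.sum_comm (s := (Finset.univ : Finset (∀ x, W x))), h2]
  simp [ite_and, pureState, vecMulVec_apply, mul_comm]

variable {ψ : (∀ x, Fin (d x)) → ℂ} {G : Subgroup (unitaryGroup (∀ x, Fin (d x)) ℂ)}

theorem localMatrix_mulVec_eq_expectation_smul (hψ : star ψ ⬝ᵥ ψ = 1)
    (hG : ∀ g ∈ G, ∃ c : ℂ, (g : Matrix (∀ x, Fin (d x)) (∀ x, Fin (d x)) ℂ) *ᵥ ψ = c • ψ)
    {w : ∀ x, W x} (hw : localHom W w ∈ G) : localMatrix w *ᵥ ψ = expectation ψ w • ψ := by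
  obtain ⟨c, hc⟩ := hG _ hw
  rw [coe_localHom] at hc
  rw [expectation, hc, dotProduct_smul, hψ, smul_eq_mul, mul_one]

theorem expectation_mul (hψ : star ψ ⬝ᵥ ψ = 1)
    (hG : ∀ g ∈ G, ∃ c : ℂ, (g : Matrix (∀ x, Fin (d x)) (∀ x, Fin (d x)) ℂ) *ᵥ ψ = c • ψ)
    {v w : ∀ x, W x} (hw : localHom W w ∈ G) :
    expectation ψ (v * w) = expectation ψ v * expectation ψ w := by
  rw [expectation, localMatrix_mul, ← mulVec_mulVec,
    localMatrix_mulVec_eq_expectation_smul hψ hG hw, mulVec_smul, dotProduct_smul, smul_eq_mul,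
    mul_comm]
  rfl

theorem expectation_one (hψ : star ψ ⬝ᵥ ψ = 1) : expectation (W := W) ψ 1 = 1 := by
  have : localMatrix (1 : ∀ x, W x) = 1 := tensorMatrix_one
  rw [expectation, this, one_mulVec, hψ]

/-- Otherwise `G` and `localHom W w` together would generate a larger abelian subgroup. -/
theorem exists_not_commute_of_maximal
    (hG : Maximal (fun K : Subgroup (unitaryGroup (∀ x, Fin (d x)) ℂ) =>
      K ≤ tensorGroup W ∧ ∀ g ∈ K, ∀ h ∈ K, g * h = h * g) G)
    {w : ∀ x, W x} (hw : localHom W w ∉ G) :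
    ∃ v : ∀ x, W x, localHom W v ∈ G ∧ localHom W v * localHom W w ≠ localHom W w * localHom W v := by
  by_contra! hcon
  have hcomm : ∀ g ∈ (G : Set (unitaryGroup (∀ x, Fin (d x)) ℂ)) ∪ {localHom W w},
      ∀ h ∈ (G : Set (unitaryGroup (∀ x, Fin (d x)) ℂ)) ∪ {localHom W w}, g * h = h * g := by
    have h1 : ∀ g ∈ G, g * localHom W w = localHom W w * g := by
      intro g hg
      obtain ⟨v, rfl⟩ := mem_tensorGroup.mp (hG.prop.1 hg)
      exact hcon v hg
    rintro g (hg | rfl) h (hh | rfl)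
    · exact hG.prop.2 g hg h hh
    · exact h1 g hg
    · exact (h1 h hh).symm
    · rfl
  have hle : Subgroup.closure ((G : Set (unitaryGroup (∀ x, Fin (d x)) ℂ)) ∪ {localHom W w}) ≤ G := by
    refine hG.le_of_ge ⟨?_, ?_⟩ ?_
    · rw [Subgroup.closure_le]
      rintro g (hg | rfl)
      · exact hG.prop.1 hg
      · exact mem_tensorGroup.mpr ⟨w, rfl⟩
    · intro g hg h hh
      have := Subgroup.isMulCommutative_closure (k := (G : Set _) ∪ {localHom W w}) hcomm
      exact congrArg Subtype.val (this.is_comm.comm ⟨g, hg⟩ ⟨h, hh⟩)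
    · exact fun g hg => Subgroup.subset_closure (Or.inl hg)
  exact hw (hle (Subgroup.subset_closure (Or.inr rfl)))

theorem IsAbstractErrorGroup.exists_mul_eq_smul {n : Type*} [Fintype n] [DecidableEq n]
    {W : Subgroup (unitaryGroup n ℂ)} (hW : IsAbstractErrorGroup W) (v w : W) :
    ∃ c : ℂ, ((v * w : W) : Matrix n n ℂ) = c • ((w * v : W) : Matrix n n ℂ) := by
  have h1 := hW.quotient_comm w v
  rw [← QuotientGroup.mk_mul, ← QuotientGroup.mk_mul, QuotientGroup.eq] at h1
  obtain ⟨c, hc⟩ := hW.center_scalar _ h1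
  refine ⟨c, ?_⟩
  have : ((v * w : W) : Matrix n n ℂ) =
      ((w * v : W) : Matrix n n ℂ) * (((w * v)⁻¹ * (v * w) : W) : Matrix n n ℂ) := by
    conv_lhs => rw [← mul_inv_cancel_left (w * v) (v * w)]
    rfl
  rw [this, hc, Matrix.mul_smul, mul_one]

/-- Some `v` in the preimage of `G` satisfies `v w = λ w v` with a scalar `λ ≠ 1`. Since `ψ` is an
eigenvector of `v`, both `⟨v w⟩` and `⟨w v⟩` equal `⟨v⟩⟨w⟩`, so `(λ - 1)⟨v⟩⟨w⟩ = 0`, while `⟨v⟩ ≠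
0`. -/
theorem expectation_eq_zero (hW : ∀ x, IsAbstractErrorGroup (W x)) (hψ : star ψ ⬝ᵥ ψ = 1)
    (hG : Maximal (fun K : Subgroup (unitaryGroup (∀ x, Fin (d x)) ℂ) =>
      K ≤ tensorGroup W ∧ ∀ g ∈ K, ∀ h ∈ K, g * h = h * g) G)
    (hGψ : ∀ g ∈ G, ∃ c : ℂ, (g : Matrix (∀ x, Fin (d x)) (∀ x, Fin (d x)) ℂ) *ᵥ ψ = c • ψ)
    {w : ∀ x, W x} (hw : localHom W w ∉ G) : expectation ψ w = 0 := by
  obtain ⟨v, hv, hvw⟩ := exists_not_commute_of_maximal hG hw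
  choose c hc using fun x => (hW x).exists_mul_eq_smul (v x) (w x)
  have h1 : localMatrix (v * w) = (∏ x, c x) • localMatrix (w * v) := localMatrix_smul hc
  have hne : ∏ x, c x ≠ 1 := by
    intro h
    rw [h, one_smul, localMatrix_mul, localMatrix_mul] at h1
    exact hvw (Subtype.ext h1)
  have hv' : localHom W v⁻¹ ∈ G := by
    rw [map_inv]
    exact inv_mem hv
  -- `expectation_mul` needs its right factor in the preimage of `G`; passing to adjoints moves `v`
  -- to the right.
  have h2 : expectation ψ (v * w) = expectation ψ v * expectation ψ w := by
    rw [← inv_inv (v * w), expectation_inv, _root_.mul_inv_rev, expectation_mul hψ hGψ hv',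
      expectation_inv, expectation_inv, star_mul', star_star, star_star, mul_comm]
  have h3 : expectation ψ (v * w) = (∏ x, c x) * (expectation ψ w * expectation ψ v) := by
    rw [← expectation_mul hψ hGψ hv, expectation, h1, smul_mulVec, dotProduct_smul, smul_eq_mul]
    rfl
  have h4 : expectation ψ v ≠ 0 := by
    intro h
    have := expectation_mul hψ hGψ (v := v⁻¹) hv
    rw [h, mul_zero, inv_mul_cancel, expectation_one hψ] at this
    exact one_ne_zero this
  have h5 : (∏ x, c x - 1) * (expectation ψ v * expectation ψ w) = 0 := by
    linear_combination h2 - h3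
  simpa [sub_eq_zero, hne, h4] using h5

end Stabilised

/-! ### Flatness of the reduced states of a stabiliser state. -/

section Stabilised

variable {P : Type*} [Fintype P] [DecidableEq P] {d : P → ℕ}
  {W : ∀ x, Subgroup (unitaryGroup (Fin (d x)) ℂ)}

/-- The factor on the parties in `J` of a product of local unitaries. -/
def localRestrict (J : Finset P) (w : ∀ x, W x) :
    Matrix (∀ x : {x // x ∈ J}, Fin (d x)) (∀ x : {x // x ∈ J}, Fin (d x)) ℂ :=
  tensorMatrix (d := fun x : {x // x ∈ J} => d x) fun x =>
    ((w x).1 : Matrix (Fin (d x)) (Fin (d x)) ℂ)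

/-- The trace of the factor off `J` of a product of local unitaries. -/
def traceOff (J : Finset P) (w : ∀ x, W x) : ℂ :=
  ∏ x : {x // x ∉ J}, ((w x).1 : Matrix (Fin (d x)) (Fin (d x)) ℂ).trace

theorem reducedState_localMatrix (J : Finset P) (w : ∀ x, W x) :
    reducedState (localMatrix w) J = traceOff J w • localRestrict J w := by
  ext i j
  have h1 : ∀ k, localMatrix w (glue J i k) (glue J j k) = localRestrict J w i j *
      ∏ x : {x // x ∉ J}, ((w x).1 : Matrix (Fin (d x)) (Fin (d x)) ℂ) (k x) (k x) := by
    intro k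
    rw [localMatrix, tensorMatrix, of_apply, ← Fintype.prod_subtype_mul_prod_subtype (· ∈ J)]
    refine congrArg₂ (· * ·) ?_ (Fintype.prod_congr _ _ fun x => ?_)
    · rw [localRestrict, tensorMatrix, of_apply]
      refine Finset.prod_congr (by congr!) fun x _ => ?_
      simp [glue]
    · simp [glue, x.2]
  rw [reducedState, of_apply, Finset.sum_congr rfl fun k _ => h1 k, ← Finset.mul_sum,
    Matrix.smul_apply, smul_eq_mul, mul_comm, traceOff]
  congr 1
  exact (Fintype.prod_sum fun (x : {x // x ∉ J}) (a : Fin (d x)) =>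
    ((w x).1 : Matrix (Fin (d x)) (Fin (d x)) ℂ) a a).symm

omit [Fintype P] in
theorem localRestrict_mul (J : Finset P) (v w : ∀ x, W x) :
    localRestrict J (v * w) = localRestrict J v * localRestrict J w :=
  tensorMatrix_mul (d := fun x : {x // x ∈ J} => d x) _ _

theorem traceOff_eq_zero (hW : ∀ x, IsAbstractErrorGroup (W x)) {J : Finset P} {w : ∀ x, W x}
    {x : P} (hx : x ∉ J) (hw : w x ∉ Subgroup.center (W x)) : traceOff J w = 0 :=
  Finset.prod_eq_zero (Finset.mem_univ (⟨x, hx⟩ : {x // x ∉ J})) ((hW x).trace_eq_zero _ hw)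

theorem traceOff_mul (hW : ∀ x, IsAbstractErrorGroup (W x)) {J : Finset P} {v w : ∀ x, W x}
    (hv : ∀ x ∉ J, v x ∈ Subgroup.center (W x)) (hw : ∀ x ∉ J, w x ∈ Subgroup.center (W x)) :
    traceOff J v * traceOff J w = (∏ x : {x // x ∉ J}, (d x : ℂ)) * traceOff J (v * w) := by
  rw [traceOff, traceOff, traceOff, ← Finset.prod_mul_distrib, ← Finset.prod_mul_distrib]
  refine Finset.prod_congr rfl fun x _ => ?_
  obtain ⟨a, ha⟩ := (hW x).center_scalar _ (hv x x.2)
  obtain ⟨b, hb⟩ := (hW x).center_scalar _ (hw x x.2)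
  have : (((v * w) x).1 : Matrix (Fin (d x)) (Fin (d x)) ℂ) = (a * b) • 1 := by
    change ((v x).1 : Matrix (Fin (d x)) (Fin (d x)) ℂ) * (w x).1 = _
    rw [ha, hb, smul_mul_smul_comm, one_mul]
  rw [this, ha, hb]
  simp only [trace_smul, trace_one, Fintype.card_fin, smul_eq_mul]
  ring

theorem reducedState_smul (J : Finset P) (c : ℂ) (ρ : Matrix (∀ x, Fin (d x)) (∀ x, Fin (d x)) ℂ) :
    reducedState (c • ρ) J = c • reducedState ρ J := by
  ext i j
  simp [reducedState, Finset.mul_sum]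

theorem reducedState_sum {ι : Type*} (s : Finset ι) (J : Finset P)
    (ρ : ι → Matrix (∀ x, Fin (d x)) (∀ x, Fin (d x)) ℂ) :
    reducedState (∑ a ∈ s, ρ a) J = ∑ a ∈ s, reducedState (ρ a) J := by
  ext i j
  simp only [reducedState, of_apply, Matrix.sum_apply]
  exact Finset.sum_comm

/-- A set of matrices indexed by a finite group and multiplicative up to a constant has a sum which
is proportional to its square. -/
theorem sum_mul_sum_of_group {Γ R : Type*} [Group Γ] [Fintype Γ] [Ring R] [Algebra ℂ R] {t : Γ → R}
    {c : ℂ} (ht : ∀ g h, t g * t h = c • t (g * h)) :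
    (∑ g, t g) * ∑ g, t g = (c * Nat.card Γ) • ∑ g, t g := by
  rw [Finset.sum_mul_sum]
  have h1 : ∀ g, ∑ h, t g * t h = c • ∑ h, t h := by
    intro g
    rw [Finset.sum_congr rfl fun h _ => ht g h, ← Finset.smul_sum]
    congr 1
    exact Fintype.sum_equiv (Equiv.mulLeft g) _ _ fun _ => rfl
  rw [Finset.sum_congr rfl fun g _ => h1 g, Finset.sum_const, Finset.card_univ,
    ← Nat.card_eq_fintype_card, ← Nat.cast_smul_eq_nsmul ℂ, smul_smul, mul_comm]

/-- The reduced states of a stabiliser state are flat, and their entropies are, up to a modular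
function, logarithms of orders of intersections of normal subgroups of a finite group. -/
theorem exists_subgroups_of_isStabiliserState (hW : ∀ x, IsAbstractErrorGroup (W x))
    {ψ : (∀ x, Fin (d x)) → ℂ} (hψ : IsStabiliserState (tensorGroup W) ψ) :
    ∃ (Γ : Subgroup (∀ x, W x)) (_ : Finite Γ) (N : P → Subgroup Γ) (_ : ∀ x, (N x).Normal)
      (c : ℝ) (δ : P → ℝ), ∀ J : Finset P, reducedEntropy ψ Jᶜ = reducedEntropy ψ J ∧
        reducedEntropy ψ Jᶜ = c - ∑ x ∈ J, δ x - Real.log (Nat.card (⨅ x ∈ J, N x : Subgroup Γ)) := by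
  classical
  obtain ⟨hψ, G, hG, hGψ⟩ := hψ
  -- A unit vector has a non-empty index set, so no local dimension is zero.
  have hd : ∀ x, 0 < d x := by
    have : Nonempty (∀ x, Fin (d x)) := by
      by_contra h
      rw [not_nonempty_iff] at h
      simp [dotProduct] at hψ
    obtain ⟨i⟩ := this
    exact fun x => (i x).pos
  have hne : ∀ x, Nonempty (Fin (d x)) := fun x => ⟨⟨0, hd x⟩⟩
  have hfin : ∀ x, Finite (W x) := fun x => (hW x).finite
  have hft : ∀ x, Fintype (W x) := fun x => Fintype.ofFinite _
  choose a ha0 ha using fun x => (hW x).exists_sum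
  set C := ∏ x, a x with hC
  have hC0 : 0 < C := Finset.prod_pos fun x _ => ha0 x
  have hsum := smul_pureState_eq_sum ψ (sum_localMatrix ha)
  let Γ : Subgroup (∀ x, W x) := G.comap (localHom W)
  -- `N x` consists of the stabilising tuples that act as a scalar at the party `x`.
  let N : P → Subgroup Γ := fun x =>
    (Subgroup.center (W x)).comap ((Pi.evalMonoidHom (fun x => W x) x).comp Γ.subtype)
  let K : Finset P → Subgroup Γ := fun J => ⨅ x ∈ J, N x
  have hK : ∀ J (w : Γ), w ∈ K J ↔ ∀ x ∈ J, w.1 x ∈ Subgroup.center (W x) := by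
    intro J w
    simp only [K, Subgroup.mem_iInf]
    rfl
  have hflat : ∀ J : Finset P, reducedState (pureState ψ) J * reducedState (pureState ψ) J =
      (((∏ x ∈ Jᶜ, (d x : ℝ)) * Nat.card (K Jᶜ) / C : ℝ) : ℂ) • reducedState (pureState ψ) J := by
    intro J
    let t : K Jᶜ → Matrix (∀ x : {x // x ∈ J}, Fin (d x)) (∀ x : {x // x ∈ J}, Fin (d x)) ℂ :=
      fun w => (star (expectation ψ w.1.1) * traceOff J w.1.1) • localRestrict J w.1.1
    -- In the partial trace only the tuples in `Γ` that are central at every traced-out party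
    -- survive: the others have zero expectation or a traceless factor off `J`.
    have h1 : (C : ℂ) • reducedState (pureState ψ) J = ∑ w, t w := by
      rw [← reducedState_smul, hsum, reducedState_sum]
      simp only [reducedState_smul, reducedState_localMatrix, smul_smul]
      symm
      refine Fintype.sum_of_injective (fun w : K Jᶜ => w.1.1)
        (Subtype.val_injective.comp Subtype.val_injective) _ _ (fun w hw => ?_) fun _ => rfl
      by_cases hwG : localHom W w ∈ G
      · have : ¬ ∀ x ∈ Jᶜ, w x ∈ Subgroup.center (W x) := fun h =>
          hw ⟨⟨⟨w, hwG⟩, (hK _ _).mpr h⟩, rfl⟩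
        push Not at this
        obtain ⟨x, hx, hwx⟩ := this
        rw [traceOff_eq_zero hW (Finset.mem_compl.mp hx) hwx, mul_zero, zero_smul]
      · rw [expectation_eq_zero hW hψ hG hGψ hwG, star_zero, zero_mul, zero_smul]
    have h2 : ∀ v w, t v * t w = (∏ x : {x // x ∉ J}, (d x : ℂ)) • t (v * w) := by
      intro v w
      have hv := (hK _ _).mp v.2
      have hw := (hK _ _).mp w.2
      simp only [t]
      change _ = (∏ x : {x // x ∉ J}, (d x : ℂ)) •
        (star (expectation ψ (v.1.1 * w.1.1)) * traceOff J (v.1.1 * w.1.1)) •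
          localRestrict J (v.1.1 * w.1.1)
      rw [expectation_mul hψ hGψ w.1.2, localRestrict_mul, smul_mul_smul_comm, smul_smul, star_mul']
      congr 1
      have := traceOff_mul hW (J := J) (v := v.1.1) (w := w.1.1)
        (fun x hx => hv x (Finset.mem_compl.mpr hx)) (fun x hx => hw x (Finset.mem_compl.mpr hx))
      linear_combination (star (expectation ψ v.1.1) * star (expectation ψ w.1.1)) * this
    have h3 := sum_mul_sum_of_group h2
    rw [← h1, smul_mul_smul_comm, smul_smul] at h3
    have hC' : (C : ℂ) ≠ 0 := Complex.ofReal_ne_zero.mpr hC0.ne'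
    have h4 : (∏ x : {x // x ∉ J}, (d x : ℂ)) = ((∏ x ∈ Jᶜ, (d x : ℝ) : ℝ) : ℂ) := by
      push_cast
      exact (Finset.prod_subtype (p := fun x => x ∉ J) Jᶜ (fun x => Finset.mem_compl)
        fun x => (d x : ℂ)).symm
    rw [h4] at h3
    have h5 := congrArg (fun A => ((C : ℂ) * C)⁻¹ • A) h3
    simp only [smul_smul] at h5
    rw [inv_mul_cancel₀ (mul_ne_zero hC' hC'), one_smul] at h5
    rw [h5]
    congr 1
    push_cast
    field_simp
  refine ⟨Γ, inferInstance, N, fun x => inferInstance, Real.log C, fun x => Real.log (d x),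
    fun J => ⟨reducedEntropy_compl_of_mul_self hψ (hflat J) (hflat Jᶜ), ?_⟩⟩
  rw [reducedEntropy_of_mul_self hψ (hflat Jᶜ), compl_compl]
  have h1 : (∏ x ∈ J, (d x : ℝ)) ≠ 0 := Finset.prod_ne_zero_iff.mpr fun x _ =>
    Nat.cast_ne_zero.mpr (hd x).ne'
  have h2 : (Nat.card (K J) : ℝ) ≠ 0 := Nat.cast_ne_zero.mpr Nat.card_pos.ne'
  rw [Real.log_div (mul_ne_zero h1 h2) hC0.ne', Real.log_mul h1 h2, Real.log_prod]
  · ring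
  · exact fun x _ => Nat.cast_ne_zero.mpr (hd x).ne'

end Stabilised

/-! ### The Ingleton inequality for stabiliser states -/

section Ingleton

variable {Γ : Type*} [Group Γ] [Finite Γ]

omit [Finite Γ] in
theorem card_inf_mul_relIndex (H K : Subgroup Γ) :
    Nat.card (H ⊓ K : Subgroup Γ) * K.relIndex H = Nat.card H := by
  have := Subgroup.relIndex_mul_relIndex (⊥ : Subgroup Γ) (K ⊓ H) H bot_le inf_le_right
  rwa [Subgroup.relIndex_bot_left, Subgroup.relIndex_bot_left, Subgroup.inf_relIndex_right,
    inf_comm] at this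

/-- The product set `HK` lies in `M` and has `|H| |K| / |H ⊓ K|` elements; relative indices express
this without forming the product set. -/
theorem log_card_add_log_card_le {H K M : Subgroup Γ} (hH : H ≤ M) (hK : K ≤ M) :
    Real.log (Nat.card H) + Real.log (Nat.card K) ≤
      Real.log (Nat.card M) + Real.log (Nat.card (H ⊓ K : Subgroup Γ)) := by
  have pos : ∀ L : Subgroup Γ, (0 : ℝ) < Nat.card L := fun L => Nat.cast_pos.mpr Nat.card_pos
  rw [← Real.log_mul (pos _).ne' (pos _).ne', ← Real.log_mul (pos _).ne' (pos _).ne']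
  refine Real.log_le_log (mul_pos (pos _) (pos _)) ?_
  norm_cast
  have h1 := card_inf_mul_relIndex H K
  have h2 := card_inf_mul_relIndex M K
  rw [inf_eq_right.mpr hK] at h2
  have h3 : K.relIndex H ≤ K.relIndex M :=
    Subgroup.relIndex_le_of_le_right hH fun h => by
      rw [h, mul_zero] at h2
      exact Nat.card_pos.ne' h2.symm
  rw [← h1, ← h2]
  calc _ = Nat.card (H ⊓ K : Subgroup Γ) * Nat.card K * K.relIndex H := by ring
    _ ≤ Nat.card (H ⊓ K : Subgroup Γ) * Nat.card K * K.relIndex M := Nat.mul_le_mul_left _ h3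
    _ = _ := by ring

theorem log_card_sup {H K : Subgroup Γ} [K.Normal] :
    Real.log (Nat.card (H ⊔ K : Subgroup Γ)) =
      Real.log (Nat.card H) + Real.log (Nat.card K) - Real.log (Nat.card (H ⊓ K : Subgroup Γ)) := by
  have pos : ∀ L : Subgroup Γ, (0 : ℝ) < Nat.card L := fun L => Nat.cast_pos.mpr Nat.card_pos
  rw [eq_sub_iff_add_eq, ← Real.log_mul (pos _).ne' (pos _).ne',
    ← Real.log_mul (pos _).ne' (pos _).ne']
  congr 1
  norm_cast
  have h1 := card_inf_mul_relIndex H K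
  have h2 := card_inf_mul_relIndex (H ⊔ K) K
  rw [inf_eq_right.mpr (le_sup_right : K ≤ H ⊔ K), Subgroup.relIndex_sup_right] at h2
  rw [← h1, ← h2]
  ring

/-- The Ingleton inequality for the orders of the intersections of subgroups. -/
theorem ingleton_subgroups (A B C D : Subgroup Γ) [B.Normal] :
    Real.log (Nat.card (A ⊓ C : Subgroup Γ)) + Real.log (Nat.card (B ⊓ C : Subgroup Γ)) +
      Real.log (Nat.card (A ⊓ D : Subgroup Γ)) + Real.log (Nat.card (B ⊓ D : Subgroup Γ)) +
      Real.log (Nat.card (A ⊓ B : Subgroup Γ)) ≤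
    Real.log (Nat.card (A ⊓ B ⊓ C : Subgroup Γ)) + Real.log (Nat.card (A ⊓ B ⊓ D : Subgroup Γ)) +
      Real.log (Nat.card (C ⊓ D : Subgroup Γ)) + Real.log (Nat.card A) + Real.log (Nat.card B) := by
  -- `A ⊔ B` plays the role of the common information of `A` and `B`: normality gives its order
  -- exactly, while the other three steps are the product bound inside `(A ⊔ B) ⊓ C`, `(A ⊔ B) ⊓ D`
  -- and `A ⊔ B`.
  have h1 := log_card_sup (H := A) (K := B)
  have h2 := log_card_add_log_card_le (H := A ⊓ C) (K := B ⊓ C) (M := (A ⊔ B) ⊓ C)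
    (inf_le_inf_right C le_sup_left) (inf_le_inf_right C le_sup_right)
  have h3 := log_card_add_log_card_le (H := A ⊓ D) (K := B ⊓ D) (M := (A ⊔ B) ⊓ D)
    (inf_le_inf_right D le_sup_left) (inf_le_inf_right D le_sup_right)
  have h4 := log_card_add_log_card_le (H := (A ⊔ B) ⊓ C) (K := (A ⊔ B) ⊓ D) (M := A ⊔ B)
    inf_le_left inf_le_left
  have h5 : Real.log (Nat.card ((A ⊔ B) ⊓ C ⊓ ((A ⊔ B) ⊓ D) : Subgroup Γ)) ≤
      Real.log (Nat.card (C ⊓ D : Subgroup Γ)) :=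
    Real.log_le_log (Nat.cast_pos.mpr Nat.card_pos) (Nat.cast_le.mpr
      (Subgroup.card_le_of_le (inf_le_inf inf_le_right inf_le_right)))
  rw [← inf_inf_distrib_right] at h2 h3
  linarith

end Ingleton

/-! ### From the entropies of a stabiliser state to the closed convex cone. -/

theorem map_restrictParties {N : ℕ} {J : Finset (Fin (N + 1))} (hJ : Fin.last N ∉ J) :
    (restrictParties J).map Fin.castSuccEmb = J := by
  ext x
  simp only [restrictParties, Finset.mem_map, Finset.mem_filter, Finset.mem_univ, true_and,
    Fin.coe_castSuccEmb]
  constructor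
  · rintro ⟨i, hi, rfl⟩
    exact hi
  · intro hx
    have hne : x ≠ Fin.last N := fun h => hJ (h ▸ hx)
    exact ⟨x.castPred hne, by simpa using hx, by simp⟩

/-- Once complementary entropies agree, the formal purification of the four-party vector is the
actual entropy function on all five parties. -/
theorem purification_reducedEntropy {N : ℕ} {d : Fin (N + 1) → ℕ} {ψ : (∀ x, Fin (d x)) → ℂ}
    {v : Finset (Fin N) → ℝ} (hv : ∀ J, v J = reducedEntropy ψ (J.map Fin.castSuccEmb))
    (hψ : ∀ J, reducedEntropy ψ Jᶜ = reducedEntropy ψ J) (J : Finset (Fin (N + 1))) :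
    purification v J = reducedEntropy ψ J := by
  rw [purification]
  split_ifs with h
  · rw [hv, map_restrictParties (by simpa using h), hψ]
  · rw [hv, map_restrictParties h]

theorem ingleton_nonneg_of_subgroups {α Γ : Type*} [DecidableEq α] [Group Γ] [Finite Γ]
    {N : α → Subgroup Γ} (hN : ∀ x, (N x).Normal) {S : Finset α → ℝ} {c : ℝ} {δ : α → ℝ}
    (hS : ∀ J, S J = c - ∑ x ∈ J, δ x - Real.log (Nat.card (⨅ x ∈ J, N x : Subgroup Γ)))
    {A B C D : α} (hAB : A ≠ B) (hAC : A ≠ C) (hAD : A ≠ D) (hBC : B ≠ C) (hBD : B ≠ D)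
    (hCD : C ≠ D) : 0 ≤ ingleton S {A} {B} {C} {D} := by
  have h1 : ∀ a, S {a} = c - δ a - Real.log (Nat.card (N a)) := fun a => by
    rw [hS, Finset.sum_singleton, Finset.iInf_singleton]
  have h2 : ∀ a b, a ≠ b → S ({a} ∪ {b}) =
      c - (δ a + δ b) - Real.log (Nat.card (N a ⊓ N b : Subgroup Γ)) := fun a b hab => by
    rw [hS, Finset.sum_union (by simpa using hab), Finset.iInf_union]
    simp only [Finset.sum_singleton, Finset.iInf_singleton]
  have h3 : ∀ a b e, a ≠ b → a ≠ e → b ≠ e → S ({a} ∪ {b} ∪ {e}) =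
      c - (δ a + δ b + δ e) - Real.log (Nat.card (N a ⊓ N b ⊓ N e : Subgroup Γ)) :=
    fun a b e hab hae hbe => by
      rw [hS, Finset.sum_union (by simp [hae.symm, hbe.symm]), Finset.sum_union (by simpa using hab),
        Finset.iInf_union, Finset.iInf_union]
      simp only [Finset.sum_singleton, Finset.iInf_singleton]
  have := hN B
  have key := ingleton_subgroups (N A) (N B) (N C) (N D)
  rw [ingleton, condMutualInfo, condMutualInfo, mutualInfo, mutualInfo, h1, h1, h1, h1,
    h2 A B hAB, h2 A C hAC, h2 A D hAD, h2 B C hBC, h2 B D hBD, h2 C D hCD,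
    h3 A B C hAB hAC hBC, h3 A B D hAB hAD hBD]
  linarith

theorem satisfiesIngleton_of_mem_stabiliserEntropyVectors {v : Finset (Fin 4) → ℝ}
    (hv : v ∈ stabiliserEntropyVectors 4) : SatisfiesIngleton v := by
  obtain ⟨d, W, ψ, hW, hψ, hv⟩ := hv
  obtain ⟨Γ, _, N, hN, c, δ, h⟩ := exists_subgroups_of_isStabiliserState hW hψ
  intro σ
  refine ingleton_nonneg_of_subgroups hN (c := c) (δ := δ) (fun J => ?_)
    (σ.injective.ne (by decide)) (σ.injective.ne (by decide)) (σ.injective.ne (by decide))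
    (σ.injective.ne (by decide)) (σ.injective.ne (by decide)) (σ.injective.ne (by decide))
  rw [purification_reducedEntropy hv (fun J => (h J).1), ← (h J).1, (h J).2]

theorem purification_add {N : ℕ} (S T : Finset (Fin N) → ℝ) (J : Finset (Fin (N + 1))) :
    purification (S + T) J = purification S J + purification T J := by
  rw [purification, purification, purification]
  split_ifs <;> rfl

theorem purification_smul {N : ℕ} (c : ℝ) (S : Finset (Fin N) → ℝ) (J : Finset (Fin (N + 1))) :
    purification (c • S) J = c * purification S J := by
  rw [purification, purification]
  split_ifs <;> rfl

theorem continuous_purification {N : ℕ} (J : Finset (Fin (N + 1))) :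
    Continuous fun S : Finset (Fin N) → ℝ => purification S J := by
  unfold purification
  split_ifs <;> exact continuous_apply _

/-- The Ingleton inequalities are linear and continuous in `S`, so the vectors satisfying them form
a closed convex cone. -/
theorem IsStabiliserRepresented.satisfiesIngleton {S : Finset (Fin 4) → ℝ}
    (hS : IsStabiliserRepresented S) : SatisfiesIngleton S := by
  refine closure_minimal (t := {S | SatisfiesIngleton S}) (fun S hS => ?_) ?_ hS
  · induction hS using Submodule.span_induction with
    | mem v hv => exact satisfiesIngleton_of_mem_stabiliserEntropyVectors hv
    | zero =>
      intro σ
      simp [ingleton, condMutualInfo, mutualInfo, purification]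
    | add S T _ _ hS hT =>
      intro σ
      refine (add_nonneg (hS σ) (hT σ)).trans_eq ?_
      simp only [ingleton, condMutualInfo, mutualInfo, purification_add]
      ring
    | smul c S _ hS =>
      intro σ
      refine (mul_nonneg c.2 (hS σ)).trans_eq ?_
      change _ = ingleton (purification ((c : ℝ) • S)) _ _ _ _
      simp only [ingleton, condMutualInfo, mutualInfo, purification_smul]
      ring
  · simp only [SatisfiesIngleton, Set.ofPred_forall]
    refine isClosed_iInter fun σ => isClosed_le continuous_const ?_
    unfold ingleton condMutualInfo mutualInfo
    have := @continuous_purification 4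
    fun_prop

/-! ### The Weyl–Heisenberg group of a finite abelian group -/

section Weyl

variable {n A : Type*} [Fintype n] [DecidableEq n] [AddCommGroup A] [Fintype A] [DecidableEq A]

omit [Fintype n] [DecidableEq n] [Fintype A] in
/-- The operator `f ↦ c • (χ * f)(· - a)` on the functions on a finite abelian group, whose elements
are labelled by `e`. -/
def weyl (e : n ≃ A) (c : ℂ) (a : A) (χ : AddChar A ℂ) : Matrix n n ℂ :=
  of fun i j => if e i = a + e j then c * χ (e j) else 0

omit [DecidableEq n] [Fintype A] in
theorem weyl_mul (e : n ≃ A) (c c' : ℂ) (a a' : A) (χ χ' : AddChar A ℂ) :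
    weyl e c a χ * weyl e c' a' χ' = weyl e (c * c' * χ a') (a + a') (χ * χ') := by
  ext i j
  rw [mul_apply, Finset.sum_eq_single (e.symm (a' + e j))]
  · simp only [weyl, of_apply, Equiv.apply_symm_apply, if_true, add_assoc, ite_mul, zero_mul,
      AddChar.map_add_eq_mul, AddChar.mul_apply]
    congr 1
    ring
  · intro k _ hk
    have : e k ≠ a' + e j := fun h => hk (by rw [← h, e.symm_apply_apply])
    simp [weyl, this]
  · simp

omit [Fintype n] [Fintype A] in
theorem weyl_one_zero (e : n ≃ A) (c : ℂ) : weyl e c 0 1 = c • (1 : Matrix n n ℂ) := by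
  ext i j
  simp [weyl, one_apply]

omit [Fintype n] [DecidableEq n] in
theorem star_weyl (e : n ≃ A) (c : ℂ) (a : A) (χ : AddChar A ℂ) :
    star (weyl e c a χ) = weyl e (star c * χ a) (-a) χ⁻¹ := by
  ext i j
  simp only [weyl, star_apply, of_apply, AddChar.inv_apply]
  by_cases h : e j = a + e i
  · have h' : e i = -a + e j := by rw [h, neg_add_cancel_left]
    have hconj : star (χ (e i)) = χ (-e i) := (AddChar.map_neg_eq_conj χ (e i)).symm
    rw [if_pos h, if_pos h', star_mul', h, hconj,
      neg_add, AddChar.map_add_eq_mul, mul_assoc, ← mul_assoc (χ a), ← AddChar.map_add_eq_mul,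
      add_neg_cancel, AddChar.map_zero_eq_one, one_mul]
  · have h' : e i ≠ -a + e j := fun h' => h (by rw [h', add_neg_cancel_left])
    rw [if_neg h, if_neg h', star_zero]

omit [Fintype n] [DecidableEq n] [Fintype A] in
theorem weyl_inj {e : n ≃ A} {c c' : ℂ} {a a' : A} {χ χ' : AddChar A ℂ} (hc : c ≠ 0)
    (h : weyl e c a χ = weyl e c' a' χ') : c = c' ∧ a = a' ∧ χ = χ' := by
  have h1 : ∀ x, c * χ x = if a + x = a' + x then c' * χ' x else 0 := by
    intro x
    have := congrFun (congrFun h (e.symm (a + x))) (e.symm x)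
    simpa [weyl] using this
  have ha : a = a' := by
    by_contra hne
    have := h1 0
    rw [if_neg (by simpa using hne)] at this
    simp [hc] at this
  subst ha
  simp only [if_true] at h1
  have hcc : c = c' := by simpa using h1 0
  subst hcc
  exact ⟨rfl, rfl, DFunLike.ext _ _ fun x => mul_left_cancel₀ hc (h1 x)⟩

omit [DecidableEq A] in
theorem addChar_pow_card (χ : AddChar A ℂ) (a : A) : χ a ^ Fintype.card A = 1 := by
  rw [← AddChar.map_nsmul_eq_pow, card_nsmul_eq_zero, AddChar.map_zero_eq_one]

omit [DecidableEq A] in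
theorem ne_zero_of_pow_card {c : ℂ} (hc : c ^ Fintype.card A = 1) : c ≠ 0 := by
  rintro rfl
  rw [zero_pow Fintype.card_ne_zero] at hc
  exact zero_ne_one hc

omit [DecidableEq A] in
theorem addChar_ne_zero (χ : AddChar A ℂ) (a : A) : χ a ≠ 0 :=
  ne_zero_of_pow_card (A := A) (addChar_pow_card χ a)

/-- The Weyl–Heisenberg group of a finite abelian group. -/
def weylGroup (e : n ≃ A) : Subgroup (unitaryGroup n ℂ) where
  carrier := {u | ∃ c a χ, c ^ Fintype.card A = 1 ∧ (u : Matrix n n ℂ) = weyl e c a χ}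
  one_mem' := ⟨1, 0, 1, one_pow _, by rw [weyl_one_zero, one_smul]; rfl⟩
  mul_mem' := by
    rintro u v ⟨c, a, χ, hc, hu⟩ ⟨c', a', χ', hc', hv⟩
    refine ⟨c * c' * χ a', a + a', χ * χ', ?_, ?_⟩
    · rw [mul_pow, mul_pow, hc, hc', addChar_pow_card, one_mul, one_mul]
    · rw [← weyl_mul, ← hu, ← hv]
      rfl
  inv_mem' := by
    rintro u ⟨c, a, χ, hc, hu⟩
    refine ⟨star c * χ a, -a, χ⁻¹, ?_, ?_⟩
    · rw [mul_pow, ← star_pow, hc, star_one, addChar_pow_card, one_mul]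
    · rw [← star_weyl, ← hu]
      rfl

/-- The element of the Weyl–Heisenberg group with the given phase, translation and character. -/
def weylElement (e : n ≃ A) (c : ℂ) (hc : c ^ Fintype.card A = 1) (a : A) (χ : AddChar A ℂ) :
    weylGroup e :=
  ⟨⟨weyl e c a χ, by
    have hcc : star c * c = 1 := by
      have := Complex.conj_mul' c
      rw [Complex.norm_eq_one_of_pow_eq_one hc Fintype.card_ne_zero] at this
      simpa using this
    rw [mem_unitaryGroup_iff', star_weyl, weyl_mul, AddChar.inv_apply, neg_add_cancel,
      inv_mul_cancel, weyl_one_zero]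
    have : star c * χ a * c * χ (-a) = (star c * c) * (χ a * χ (-a)) := by ring
    rw [this, hcc, ← AddChar.map_add_eq_mul, add_neg_cancel, AddChar.map_zero_eq_one, one_mul,
      one_smul]⟩, c, a, χ, hc, rfl⟩

/-- Commuting with multiplication by every character forces the translation to be trivial, since
characters separate points; commuting with every translation forces the character to be trivial. -/
theorem mem_center_weylGroup {e : n ≃ A} {u : weylGroup e} {c : ℂ} {a : A} {χ : AddChar A ℂ}
    (hc : c ^ Fintype.card A = 1) (hu : (u : Matrix n n ℂ) = weyl e c a χ) :
    u ∈ Subgroup.center (weylGroup e) ↔ a = 0 ∧ χ = 1 := by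
  have hc0 := ne_zero_of_pow_card (A := A) hc
  rw [Subgroup.mem_center_iff]
  constructor
  · intro h
    have h1 : ∀ a' χ', weyl e 1 a' χ' * weyl e c a χ = weyl e c a χ * weyl e 1 a' χ' := by
      intro a' χ'
      rw [← hu]
      exact congrArg (fun v : weylGroup e => (v : Matrix n n ℂ))
        (h (weylElement e 1 (one_pow _) a' χ'))
    constructor
    · rw [← AddChar.forall_apply_eq_zero]
      intro χ'
      have := h1 0 χ'
      rw [weyl_mul, weyl_mul] at this
      have := (weyl_inj (by simpa using ⟨hc0, addChar_ne_zero χ' a⟩) this).1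
      simpa [hc0] using this
    · refine DFunLike.ext _ _ fun a' => ?_
      have := h1 a' 1
      rw [weyl_mul, weyl_mul] at this
      have := (weyl_inj (by simpa using hc0) this).1
      simpa [hc0] using this.symm
  · rintro ⟨rfl, rfl⟩ v
    refine Subtype.ext (Subtype.ext ?_)
    change (v : Matrix n n ℂ) * (u : Matrix n n ℂ) = (u : Matrix n n ℂ) * (v : Matrix n n ℂ)
    rw [hu, weyl_one_zero, Matrix.mul_smul, Matrix.smul_mul, mul_one, one_mul]

theorem isAbstractErrorGroup_weylGroup (e : n ≃ A) : IsAbstractErrorGroup (weylGroup e) where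
  finite := by
    have hfin : {M : Matrix n n ℂ | ∃ c a χ, c ^ Fintype.card A = 1 ∧ M = weyl e c a χ}.Finite := by
      refine (Set.Finite.image (fun p : ℂ × A × AddChar A ℂ => weyl e p.1 p.2.1 p.2.2)
        (((Polynomial.nthRootsFinset (Fintype.card A) (1 : ℂ)).finite_toSet).prod
          (Set.finite_univ (α := A × AddChar A ℂ)))).subset ?_
      rintro _ ⟨c, a, χ, hc, rfl⟩
      exact ⟨(c, a, χ), ⟨(Polynomial.mem_nthRootsFinset Fintype.card_pos _).mpr hc, trivial⟩, rfl⟩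
    exact (hfin.preimage (f := fun u : unitaryGroup n ℂ => (u : Matrix n n ℂ))
      Subtype.val_injective.injOn).to_subtype
  center_scalar := by
    intro u hu
    obtain ⟨c, a, χ, hc, h⟩ := u.2
    obtain ⟨rfl, rfl⟩ := (mem_center_weylGroup hc h).mp hu
    exact ⟨c, by rw [h, weyl_one_zero]⟩
  quotient_comm := by
    intro p q
    obtain ⟨u, rfl⟩ := QuotientGroup.mk_surjective p
    obtain ⟨v, rfl⟩ := QuotientGroup.mk_surjective q
    rw [← QuotientGroup.mk_mul, ← QuotientGroup.mk_mul, QuotientGroup.eq]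
    obtain ⟨c, a, χ, hc, hu⟩ := u.2
    obtain ⟨c', a', χ', hc', hv⟩ := v.2
    -- The commutator is itself some `weyl e z b θ`; comparing translations and characters in `(u v)
    -- * commutator = v u` gives `b = 0` and `θ = 1`.
    obtain ⟨z, b, θ, hz, hw⟩ := ((u * v)⁻¹ * (v * u)).2
    rw [mem_center_weylGroup hz hw]
    have h1 : (((u * v) * ((u * v)⁻¹ * (v * u)) : weylGroup e) : Matrix n n ℂ) =
        ((v * u : weylGroup e) : Matrix n n ℂ) := by rw [mul_inv_cancel_left]
    change (u : Matrix n n ℂ) * (v : Matrix n n ℂ) * ((((u * v)⁻¹ * (v * u)) : weylGroup e) :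
      Matrix n n ℂ) = (v : Matrix n n ℂ) * (u : Matrix n n ℂ) at h1
    rw [hw, hu, hv, weyl_mul, weyl_mul, weyl_mul] at h1
    obtain ⟨-, h2, h3⟩ := weyl_inj (by
      simp only [ne_eq, mul_eq_zero, not_or]
      exact ⟨⟨⟨⟨ne_zero_of_pow_card (A := A) hc, ne_zero_of_pow_card (A := A) hc'⟩,
        addChar_ne_zero _ _⟩, ne_zero_of_pow_card (A := A) hz⟩,
        addChar_ne_zero _ _⟩) h1
    rw [add_comm a' a] at h2
    rw [mul_comm χ' χ] at h3
    exact ⟨by simpa using h2, by simpa using h3⟩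
  quotient_card := by
    have hone : (1 : ℂ) ^ Fintype.card A = 1 := one_pow _
    -- Cosets of the centre correspond to pairs of a translation and a character, and a finite
    -- abelian group has as many characters as elements.
    have hbij : Function.Bijective fun p : A × AddChar A ℂ =>
        (weylElement e 1 hone p.1 p.2 : weylGroup e ⧸ Subgroup.center (weylGroup e)) := by
      constructor
      · rintro ⟨a, χ⟩ ⟨a', χ'⟩ h
        rw [QuotientGroup.eq] at h
        obtain ⟨z, b, θ, hz, hw⟩ := ((weylElement e 1 hone a χ)⁻¹ * weylElement e 1 hone a' χ').2
        obtain ⟨rfl, rfl⟩ := (mem_center_weylGroup hz hw).mp h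
        have h1 : (((weylElement e 1 hone a χ) * ((weylElement e 1 hone a χ)⁻¹ *
            weylElement e 1 hone a' χ') : weylGroup e) : Matrix n n ℂ) =
            (weylElement e 1 hone a' χ' : Matrix n n ℂ) := by rw [mul_inv_cancel_left]
        change weyl e 1 a χ * (((weylElement e 1 hone a χ)⁻¹ *
            weylElement e 1 hone a' χ' : weylGroup e) : Matrix n n ℂ) = weyl e 1 a' χ' at h1
        rw [hw, weyl_mul] at h1
        obtain ⟨-, h2, h3⟩ := weyl_inj (by simpa using ne_zero_of_pow_card (A := A) hz) h1
        rw [add_zero] at h2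
        rw [mul_one] at h3
        rw [h2, h3]
      · intro q
        obtain ⟨u, rfl⟩ := QuotientGroup.mk_surjective q
        obtain ⟨c, a, χ, hc, hu⟩ := u.2
        refine ⟨(a, χ), ?_⟩
        have hmem : weylElement e c hc 0 1 ∈ Subgroup.center (weylGroup e) :=
          (mem_center_weylGroup hc rfl).mpr ⟨rfl, rfl⟩
        have : u = weylElement e 1 hone a χ * weylElement e c hc 0 1 := by
          refine Subtype.ext (Subtype.ext ?_)
          change (u : Matrix n n ℂ) = weyl e 1 a χ * weyl e c 0 1
          rw [weyl_mul, hu]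
          simp
        rw [this, QuotientGroup.mk_mul_of_mem _ hmem]
    rw [← Nat.card_congr (Equiv.ofBijective _ hbij), Nat.card_prod, Nat.card_eq_fintype_card,
      Nat.card_eq_fintype_card, AddChar.card_eq, ← Fintype.card_congr e, sq]
  trace_eq_zero := by
    intro u hu
    obtain ⟨c, a, χ, hc, h⟩ := u.2
    rw [mem_center_weylGroup hc h] at hu
    rw [h, trace]
    simp only [diag, weyl, of_apply]
    by_cases ha : a = 0
    · subst ha
      simp only [zero_add, if_true]
      rw [← Finset.mul_sum, e.sum_comp χ, AddChar.sum_eq_zero_of_ne_one fun h => hu ⟨rfl, h⟩,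
        mul_zero]
    · simp [ha]

end Weyl

/-! ### The uniform superposition of the words of a group code -/

section Code

variable {P : Type*} [Fintype P] [DecidableEq P] {A : P → Type*} [∀ x, AddCommGroup (A x)]
  [∀ x, Fintype (A x)] [∀ x, DecidableEq (A x)] {d : P → ℕ} (e : ∀ x, Fin (d x) ≃ A x)
  (L : AddSubgroup (∀ x, A x))

open Classical in
/-- The uniform superposition of the words of a group code. -/
def codeState (i : ∀ x, Fin (d x)) : ℂ :=
  if (fun x => e x (i x)) ∈ L then ((√(Nat.card L : ℝ))⁻¹ : ℝ) else 0

omit [Fintype P] [DecidableEq P] [∀ x, Fintype (A x)] [∀ x, DecidableEq (A x)] in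
theorem star_codeState (i : ∀ x, Fin (d x)) : star (codeState e L i) = codeState e L i := by
  rw [codeState]
  split_ifs
  · exact Complex.conj_ofReal _
  · exact star_zero _

omit [∀ x, DecidableEq (A x)] in
theorem star_codeState_dotProduct : star (codeState e L) ⬝ᵥ codeState e L = 1 := by
  classical
  have hpos : (0 : ℝ) < Nat.card L := Nat.cast_pos.mpr Nat.card_pos
  have h1 : ∀ i, star (codeState e L) i * codeState e L i =
      if Equiv.piCongrRight e i ∈ L then ((Nat.card L : ℝ)⁻¹ : ℂ) else 0 := by
    intro i
    rw [Pi.star_apply, star_codeState, codeState]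
    change (if Equiv.piCongrRight e i ∈ L then _ else _) * (if Equiv.piCongrRight e i ∈ L then _ else _)
      = _
    split_ifs
    · rw [← Complex.ofReal_mul, ← mul_inv, Real.mul_self_sqrt hpos.le]
      push_cast
      rfl
    · exact mul_zero _
  rw [dotProduct, Finset.sum_congr rfl fun i _ => h1 i,
    (Equiv.piCongrRight e).sum_comp fun y => if y ∈ L then ((Nat.card L : ℝ)⁻¹ : ℂ) else 0,
    ← Finset.sum_filter, Finset.sum_const, nsmul_eq_mul,
    ← Nat.subtype_card (p := (· ∈ L)) _ (fun y => by simp)]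
  push_cast
  exact mul_inv_cancel₀ (Nat.cast_ne_zero.mpr Nat.card_pos.ne')

variable {e L}

/-- The product of elements of the local Weyl–Heisenberg groups with trivial phases. -/
def weylProduct (e : ∀ x, Fin (d x) ≃ A x) (a : ∀ x, A x) (χ : ∀ x, AddChar (A x) ℂ) :
    ∀ x, weylGroup (e x) :=
  fun x => weylElement (e x) 1 (one_pow _) (a x) (χ x)

theorem weylProduct_mulVec (a : ∀ x, A x) (χ : ∀ x, AddChar (A x) ℂ) (φ : (∀ x, Fin (d x)) → ℂ)
    (i : ∀ x, Fin (d x)) :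
    (localMatrix (weylProduct e a χ) *ᵥ φ) i =
      (∏ x, χ x (-a x + e x (i x))) * φ fun x => (e x).symm (-a x + e x (i x)) := by
  rw [mulVec, dotProduct, Finset.sum_eq_single fun x => (e x).symm (-a x + e x (i x))]
  · simp [localMatrix, tensorMatrix, weylProduct, weylElement, weyl]
  · intro j _ hj
    obtain ⟨x, hx⟩ := Function.ne_iff.mp hj
    have : e x (i x) ≠ a x + e x (j x) := fun h => hx (by simp [h])
    have h0 : localMatrix (weylProduct e a χ) i j = 0 :=
      Finset.prod_eq_zero (Finset.mem_univ x)
        (by simp [weylProduct, weylElement, weyl, this])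
    rw [h0, zero_mul]
  · simp

theorem exists_addChar_of_notMem {B : Type*} [AddCommGroup B] [Finite B] {L : AddSubgroup B}
    {y : B} (hy : y ∉ L) : ∃ χ : AddChar B ℂ, (∀ l ∈ L, χ l = 1) ∧ χ y ≠ 1 := by
  obtain ⟨χ, hχ⟩ := AddChar.exists_apply_ne_zero.mpr
    (show (y : B ⧸ L) ≠ 0 from fun h => hy ((QuotientAddGroup.eq_zero_iff y).mp h))
  refine ⟨χ.compAddMonoidHom (QuotientAddGroup.mk' L), fun l hl => ?_, hχ⟩
  change χ (l : B ⧸ L) = 1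
  rw [(QuotientAddGroup.eq_zero_iff l).mpr hl, AddChar.map_zero_eq_one]

omit [∀ x, Fintype (A x)] [∀ x, DecidableEq (A x)] in
theorem addChar_prod_single (χ : AddChar (∀ x, A x) ℂ) (y : ∀ x, A x) :
    ∏ x, χ (Pi.single x (y x)) = χ y := by
  have := map_prod χ.toMonoidHom (fun x => Multiplicative.ofAdd (Pi.single x (y x))) Finset.univ
  rw [← ofAdd_sum, Finset.univ_sum_single] at this
  exact this.symm

-- Error group elements commute up to a scalar, and a common eigenvector with non-zero eigenvalues
-- forces this scalar to be `1`.
omit [∀ x, AddCommGroup (A x)] [∀ x, Fintype (A x)] [∀ x, DecidableEq (A x)] in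
theorem commute_of_mulVec_eq_smul {W : ∀ x, Subgroup (unitaryGroup (Fin (d x)) ℂ)}
    (hW : ∀ x, IsAbstractErrorGroup (W x)) {ψ : (∀ x, Fin (d x)) → ℂ} (hψ : ψ ≠ 0)
    {v w : ∀ x, W x} {c c' : ℂ} (hc0 : c ≠ 0) (hc0' : c' ≠ 0)
    (hc : localMatrix v *ᵥ ψ = c • ψ) (hc' : localMatrix w *ᵥ ψ = c' • ψ) :
    localHom W v * localHom W w = localHom W w * localHom W v := by
  choose z hz using fun x => (hW x).exists_mul_eq_smul (v x) (w x)
  have h1 : localMatrix (v * w) = (∏ x, z x) • localMatrix (w * v) := localMatrix_smul hz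
  have h2 := congrArg (· *ᵥ ψ) h1
  simp only [localMatrix_mul, smul_mulVec, ← mulVec_mulVec, hc, hc', mulVec_smul, smul_smul] at h2
  have h3 : c' * c = (∏ x, z x) * (c * c') := smul_left_injective ℂ hψ h2
  have h4 : ∏ x, z x = 1 := by
    rw [mul_comm c' c] at h3
    exact (mul_eq_right₀ (mul_ne_zero hc0 hc0')).mp h3.symm
  rw [h4, one_smul, localMatrix_mul, localMatrix_mul] at h1
  exact Subtype.ext h1

theorem isStabiliserState_codeState (e : ∀ x, Fin (d x) ≃ A x) (L : AddSubgroup (∀ x, A x)) :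
    IsStabiliserState (tensorGroup fun x => weylGroup (e x)) (codeState e L) := by
  classical
  have hnorm := star_codeState_dotProduct e L
  have hne : codeState e L ≠ 0 := by
    intro h
    rw [h, dotProduct_zero] at hnorm
    exact zero_ne_one hnorm
  have hcne : ∀ (g : unitaryGroup (∀ x, Fin (d x)) ℂ) (c : ℂ),
      (g : Matrix (∀ x, Fin (d x)) (∀ x, Fin (d x)) ℂ) *ᵥ codeState e L = c • codeState e L →
        c ≠ 0 ∧ ((g⁻¹ : unitaryGroup (∀ x, Fin (d x)) ℂ) :
          Matrix (∀ x, Fin (d x)) (∀ x, Fin (d x)) ℂ) *ᵥ codeState e L = c⁻¹ • codeState e L := by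
    intro g c h
    have h1 : codeState e L = c • (((g⁻¹ : unitaryGroup (∀ x, Fin (d x)) ℂ) :
        Matrix (∀ x, Fin (d x)) (∀ x, Fin (d x)) ℂ) *ᵥ codeState e L) := by
      rw [← mulVec_smul, ← h, mulVec_mulVec]
      have : ((g⁻¹ * g : unitaryGroup (∀ x, Fin (d x)) ℂ) :
        Matrix (∀ x, Fin (d x)) (∀ x, Fin (d x)) ℂ) = 1 := by rw [inv_mul_cancel]; rfl
      exact ((congrArg (· *ᵥ codeState e L) this).trans (one_mulVec _)).symm
    have hc : c ≠ 0 := by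
      rintro rfl
      rw [zero_smul] at h1
      exact hne h1
    exact ⟨hc, by rw [eq_inv_smul_iff₀ hc]; exact h1.symm⟩
  -- All local operators with the code state as eigenvector are taken; the content is that they
  -- commute and that no larger abelian subgroup exists.
  let G : Subgroup (unitaryGroup (∀ x, Fin (d x)) ℂ) :=
    { carrier := {g | g ∈ tensorGroup (fun x => weylGroup (e x)) ∧ ∃ c : ℂ,
        (g : Matrix (∀ x, Fin (d x)) (∀ x, Fin (d x)) ℂ) *ᵥ codeState e L = c • codeState e L}
      one_mem' := ⟨one_mem _, 1, by rw [one_smul]; exact one_mulVec _⟩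
      mul_mem' := by
        rintro g h ⟨hg, c, hc⟩ ⟨hh, c', hc'⟩
        refine ⟨mul_mem hg hh, c' * c, ?_⟩
        rw [mul_smul, ← hc, ← mulVec_smul, ← hc', mulVec_mulVec]
        rfl
      inv_mem' := by
        rintro g ⟨hg, c, hc⟩
        exact ⟨inv_mem hg, c⁻¹, (hcne g c hc).2⟩ }
  refine ⟨hnorm, G, ⟨⟨fun g hg => hg.1, ?_⟩, ?_⟩, fun g hg => hg.2⟩
  · rintro g ⟨hg, c, hc⟩ h ⟨hh, c', hc'⟩
    obtain ⟨v, rfl⟩ := mem_tensorGroup.mp hg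
    obtain ⟨w, rfl⟩ := mem_tensorGroup.mp hh
    exact commute_of_mulVec_eq_smul (fun x => isAbstractErrorGroup_weylGroup (e x)) hne
      (hcne _ c hc).1 (hcne _ c' hc').1 hc hc'
  · rintro K ⟨hKW, hK⟩ hGK k hk
    refine ⟨hKW hk, ?_⟩
    -- For `k` in an abelian group containing `G`, the vector `φ` is fixed by every operator fixing
    -- the code state. Translations by `L` make `φ` constant on `L`, and characters trivial on `L`
    -- make it vanish off `L`, so `φ` is a multiple of the code state and `k` lies in `G`.
    set φ := (k : Matrix (∀ x, Fin (d x)) (∀ x, Fin (d x)) ℂ) *ᵥ codeState e L with hφ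
    have hfix : ∀ w : ∀ x, weylGroup (e x), localMatrix w *ᵥ codeState e L = codeState e L →
        localMatrix w *ᵥ φ = φ := by
      intro w hw
      have hmem : localHom (fun x => weylGroup (e x)) w ∈ K :=
        hGK ⟨mem_tensorGroup.mpr ⟨w, rfl⟩, 1, by rw [one_smul]; exact hw⟩
      have h1 := congrArg (fun g : unitaryGroup (∀ x, Fin (d x)) ℂ =>
        (g : Matrix (∀ x, Fin (d x)) (∀ x, Fin (d x)) ℂ) *ᵥ codeState e L) (hK _ hmem _ hk)
      change (localMatrix w * (k : Matrix (∀ x, Fin (d x)) (∀ x, Fin (d x)) ℂ)) *ᵥ _ =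
        ((k : Matrix (∀ x, Fin (d x)) (∀ x, Fin (d x)) ℂ) * localMatrix w) *ᵥ _ at h1
      rwa [← mulVec_mulVec, ← mulVec_mulVec, hw] at h1
    have hshift : ∀ l ∈ L, ∀ i, φ (fun x => (e x).symm (-l x + e x (i x))) = φ i := by
      intro l hl i
      have := congrFun (hfix (weylProduct e l 1) ?_) i
      · rw [weylProduct_mulVec] at this
        simpa using this
      · funext i
        rw [weylProduct_mulVec]
        simp only [Pi.one_apply, AddChar.one_apply, Finset.prod_const_one, one_mul, codeState,
          Equiv.apply_symm_apply]
        have : (fun x => -l x + e x (i x)) ∈ L ↔ (fun x => e x (i x)) ∈ L :=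
          AddSubgroup.add_mem_cancel_left L (neg_mem hl)
        simp only [this]
    have hzero : ∀ i, (fun x => e x (i x)) ∉ L → φ i = 0 := by
      intro i hi
      obtain ⟨χ, hχL, hχ⟩ := exists_addChar_of_notMem hi
      have hprod : ∀ j : ∀ x, Fin (d x), ∏ x,
          χ.compAddMonoidHom (AddMonoidHom.single A x) (-(0 : ∀ x, A x) x + e x (j x)) =
            χ fun x => e x (j x) := by
        intro j
        rw [← addChar_prod_single]
        simp
      have := congrFun (hfix (weylProduct e 0
        fun x => χ.compAddMonoidHom (AddMonoidHom.single A x)) ?_) i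
      · rw [weylProduct_mulVec, hprod] at this
        simp only [Pi.zero_apply, neg_zero, zero_add, Equiv.symm_apply_apply] at this
        by_contra h0
        exact hχ ((mul_eq_right₀ h0).mp this)
      · funext j
        rw [weylProduct_mulVec, hprod]
        simp only [Pi.zero_apply, neg_zero, zero_add, Equiv.symm_apply_apply]
        by_cases hj : (fun x => e x (j x)) ∈ L
        · rw [hχL _ hj, one_mul]
        · rw [codeState, if_neg hj, mul_zero]
    refine ⟨φ (fun x => (e x).symm 0) * (√(Nat.card L : ℝ) : ℝ), ?_⟩
    funext i
    rw [Pi.smul_apply, smul_eq_mul, codeState]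
    split_ifs with hi
    · rw [← hshift _ hi i, mul_assoc, ← Complex.ofReal_mul, mul_inv_cancel₀
        (Real.sqrt_ne_zero'.mpr (Nat.cast_pos.mpr Nat.card_pos)), Complex.ofReal_one, mul_one]
      simp
    · rw [mul_zero, hzero i hi]

end Code

/-! ### Reduced states and entropies of code states. -/

section Marginal

theorem sum_ite_eq_natCard {X : Type*} [Fintype X] (p : X → Prop) [DecidablePred p] :
    (∑ x : X, if p x then (1 : ℂ) else 0) = Nat.card {x // p x} := by
  rw [Finset.sum_boole]
  exact congrArg Nat.cast (Nat.subtype_card _ fun x => by simp).symm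

variable {B B' : Type*} [AddCommGroup B] [AddCommGroup B'] [Fintype B] [Fintype B']

open Classical in
/-- The number of the `k` with both `(i, k)` and `(j, k)` in a subgroup. -/
def overlap (L : AddSubgroup (B × B')) (i j : B) : ℂ :=
  ∑ k, if (i, k) ∈ L ∧ (j, k) ∈ L then 1 else 0

/-- Up to normalisation `overlap` is the reduced state, and this is its flatness. After shifting the
summation variables to `i + m` and `k' + k`, the four membership conditions decouple into one on
`m`, one on `k`, and the pair defining `overlap L i j`. -/
theorem sum_overlap_mul_overlap (L : AddSubgroup (B × B')) (i j : B) :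
    ∑ m, overlap L i m * overlap L m j =
      (Nat.card {u : B // (u, (0 : B')) ∈ L} * Nat.card {w : B' // ((0 : B), w) ∈ L}) *
        overlap L i j := by
  classical
  have h1 : ∀ m k k', ((if (i, k' + k) ∈ L ∧ (i + m, k' + k) ∈ L then 1 else 0) *
      (if (i + m, k') ∈ L ∧ (j, k') ∈ L then 1 else 0) : ℂ) =
      ((if (m, (0 : B')) ∈ L then 1 else 0) * (if ((0 : B), k) ∈ L then 1 else 0)) *
        (if (i, k') ∈ L ∧ (j, k') ∈ L then 1 else 0) := by
    intro m k k'
    have e1 : ((i, k' + k) : B × B') = (i, k') + (0, k) := by simp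
    have e2 : ((i + m, k' + k) : B × B') = (i, k') + (0, k) + (m, 0) := by simp
    have e3 : ((i + m, k') : B × B') = (i, k') + (m, 0) := by simp
    have key : (((i, k' + k) ∈ L ∧ (i + m, k' + k) ∈ L) ∧ (i + m, k') ∈ L ∧ (j, k') ∈ L) ↔
        (((m, (0 : B')) ∈ L ∧ ((0 : B), k) ∈ L) ∧ (i, k') ∈ L ∧ (j, k') ∈ L) := by
      rw [e1, e2, e3]
      constructor
      · rintro ⟨⟨ha, hb⟩, hc, hd⟩
        have hm := (AddSubgroup.add_mem_cancel_left L ha).mp hb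
        have hi := (AddSubgroup.add_mem_cancel_right L hm).mp hc
        exact ⟨⟨hm, (AddSubgroup.add_mem_cancel_left L hi).mp ha⟩, hi, hd⟩
      · rintro ⟨⟨hm, hk⟩, hi, hd⟩
        exact ⟨⟨add_mem hi hk, add_mem (add_mem hi hk) hm⟩, add_mem hi hm, hd⟩
    simp only [ite_zero_mul_ite_zero, key, mul_one]
  have h2 : ∀ m, overlap L i m * overlap L m j = ∑ k', ∑ k,
      (if (i, k' + k) ∈ L ∧ (m, k' + k) ∈ L then 1 else 0) *
        (if (m, k') ∈ L ∧ (j, k') ∈ L then 1 else 0) := by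
    intro m
    rw [overlap, overlap, Finset.sum_mul_sum, Finset.sum_comm]
    exact Finset.sum_congr rfl fun k' _ => (Fintype.sum_equiv (Equiv.addLeft k') _ _ fun k => rfl).symm
  calc _ = ∑ m, ∑ k', ∑ k, (if (i, k' + k) ∈ L ∧ (i + m, k' + k) ∈ L then 1 else 0) *
        (if (i + m, k') ∈ L ∧ (j, k') ∈ L then 1 else 0 : ℂ) := by
        rw [Finset.sum_congr rfl fun m _ => h2 m]
        exact (Fintype.sum_equiv (Equiv.addLeft i) _ _ fun m => rfl).symm
    _ = _ := by
      simp only [h1, ← Finset.sum_mul, ← Finset.mul_sum, sum_ite_eq_natCard, overlap]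

end Marginal

section Code

variable {P : Type*} [Fintype P] [DecidableEq P] {A : P → Type*} [∀ x, AddCommGroup (A x)]
  [∀ x, Fintype (A x)] {d : P → ℕ} (e : ∀ x, Fin (d x) ≃ A x)
  (L : AddSubgroup (∀ x, A x))

/-- The word with components `p.1` on `J` and `p.2` off `J`. -/
def glueHom (A : P → Type*) [∀ x, AddCommGroup (A x)] (J : Finset P) :
    (∀ x : {x // x ∈ J}, A x) × (∀ x : {x // x ∉ J}, A x) →+ ∀ x, A x where
  toFun p x := if h : x ∈ J then p.1 ⟨x, h⟩ else p.2 ⟨x, h⟩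
  map_zero' := by
    funext x
    by_cases h : x ∈ J <;> simp [h]
  map_add' p q := by
    funext x
    by_cases h : x ∈ J <;> simp [h]

theorem reducedState_codeState (J : Finset P) (i j : ∀ x : {x // x ∈ J}, Fin (d x)) :
    reducedState (pureState (codeState e L)) J i j =
      (Nat.card L : ℂ)⁻¹ * overlap (L.comap (glueHom A J)) (fun x => e x (i x)) fun x => e x (j x) := by
  classical
  have hpos : (0 : ℝ) < Nat.card L := Nat.cast_pos.mpr Nat.card_pos
  rw [reducedState, of_apply, overlap, Finset.mul_sum]
  refine Fintype.sum_equiv (Equiv.piCongrRight fun x : {x // x ∉ J} => e x) _ _ fun k => ?_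
  have hglue : ∀ i : ∀ x : {x // x ∈ J}, Fin (d x), (fun x => e x (glue J i k x)) =
      glueHom A J (fun x => e x (i x), Equiv.piCongrRight (fun x : {x // x ∉ J} => e x) k) := by
    intro i
    funext x
    by_cases h : x ∈ J <;> simp [glue, glueHom, h]
  rw [pureState, vecMulVec_apply, Pi.star_apply, star_codeState, codeState, codeState, hglue, hglue,
    ite_zero_mul_ite_zero, ← Complex.ofReal_mul, ← mul_inv, Real.mul_self_sqrt hpos.le, mul_ite,
    mul_zero, mul_one]
  push_cast
  rfl

theorem reducedEntropy_codeState (J : Finset P) :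
    reducedEntropy (codeState e L) J = Real.log (Nat.card L) -
      Real.log (Nat.card {u : ∀ x : {x // x ∈ J}, A x // glueHom A J (u, 0) ∈ L}) -
      Real.log (Nat.card {u : ∀ x : {x // x ∉ J}, A x // glueHom A J (0, u) ∈ L}) := by
  have hpos : (Nat.card L : ℝ) ≠ 0 := Nat.cast_ne_zero.mpr Nat.card_pos.ne'
  have hne : Nonempty {u : ∀ x : {x // x ∈ J}, A x // glueHom A J (u, 0) ∈ L} :=
    ⟨⟨0, by rw [← Prod.zero_eq_mk, map_zero]; exact zero_mem L⟩⟩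
  have hne' : Nonempty {u : ∀ x : {x // x ∉ J}, A x // glueHom A J (0, u) ∈ L} :=
    ⟨⟨0, by rw [← Prod.zero_eq_mk, map_zero]; exact zero_mem L⟩⟩
  have h1 : (Nat.card {u : ∀ x : {x // x ∈ J}, A x // glueHom A J (u, 0) ∈ L} : ℝ) ≠ 0 :=
    Nat.cast_ne_zero.mpr Nat.card_pos.ne'
  have h2 : (Nat.card {u : ∀ x : {x // x ∉ J}, A x // glueHom A J (0, u) ∈ L} : ℝ) ≠ 0 :=
    Nat.cast_ne_zero.mpr Nat.card_pos.ne'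
  rw [reducedEntropy_of_mul_self (c := (Nat.card {u : ∀ x : {x // x ∈ J}, A x //
      glueHom A J (u, 0) ∈ L} : ℝ) * Nat.card {u : ∀ x : {x // x ∉ J}, A x //
      glueHom A J (0, u) ∈ L} / Nat.card L) (star_codeState_dotProduct e L),
    Real.log_div (mul_ne_zero h1 h2) hpos, Real.log_mul h1 h2]
  · ring
  · ext i j
    rw [mul_apply, Matrix.smul_apply, smul_eq_mul]
    simp only [reducedState_codeState]
    have key := sum_overlap_mul_overlap (L.comap (glueHom A J)) (fun x => e x (i x))
      fun x => e x (j x)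
    rw [← (Equiv.piCongrRight fun x : {x // x ∈ J} => e x).sum_comp] at key
    have h3 : ∀ m : ∀ x : {x // x ∈ J}, Fin (d x),
        (Nat.card L : ℂ)⁻¹ * overlap (L.comap (glueHom A J)) (fun x => e x (i x)) (fun x => e x (m x)) *
        ((Nat.card L : ℂ)⁻¹ * overlap (L.comap (glueHom A J)) (fun x => e x (m x)) fun x => e x (j x)) =
        ((Nat.card L : ℂ)⁻¹ * (Nat.card L : ℂ)⁻¹) *
        (overlap (L.comap (glueHom A J)) (fun x => e x (i x))
          (Equiv.piCongrRight (fun x : {x // x ∈ J} => e x) m) *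
        overlap (L.comap (glueHom A J)) (Equiv.piCongrRight (fun x : {x // x ∈ J} => e x) m)
          fun x => e x (j x)) := by
      intro m
      change _ * (_ * overlap _ (Equiv.piCongrRight (fun x : {x // x ∈ J} => e x) m) _) = _
      change _ * overlap _ _ (Equiv.piCongrRight (fun x : {x // x ∈ J} => e x) m) * _ = _
      ring
    rw [Finset.sum_congr rfl fun m _ => h3 m, ← Finset.mul_sum, key]
    push_cast
    simp only [AddSubgroup.mem_comap]
    ring

end Code

/-! ### Entropy vectors from families of subgroups -/

/-- The group codes given by the images of a finite abelian group in its quotients by a family of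
subgroups with trivial intersection are stabiliser states. -/
theorem mem_stabiliserEntropyVectors_of_subgroups {N : ℕ} {V : Type} [AddCommGroup V] [Finite V]
    (H : Fin (N + 1) → AddSubgroup V) (hH : ∀ v, (∀ x, v ∈ H x) → v = 0) :
    (fun J : Finset (Fin N) => Real.log (Nat.card V) -
      Real.log (Nat.card {v : V // ∀ x ∉ J.map Fin.castSuccEmb, v ∈ H x}) -
      Real.log (Nat.card {v : V // ∀ x ∈ J.map Fin.castSuccEmb, v ∈ H x})) ∈
        stabiliserEntropyVectors N := by
  classical
  have : ∀ x, Fintype (V ⧸ H x) := fun x => Fintype.ofFinite _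
  let e : ∀ x, Fin (Fintype.card (V ⧸ H x)) ≃ V ⧸ H x := fun x => (Fintype.equivFin _).symm
  -- The code is the image of `V`. A word `q v` is supported on `K` exactly when `v` lies in `H x`
  -- for all `x ∉ K`, which turns the two subcode orders of `reducedEntropy_codeState` into orders
  -- of intersections.
  let q : V →+ ∀ x, V ⧸ H x := AddMonoidHom.mk' (fun v x => (v : V ⧸ H x)) fun _ _ => rfl
  have hq : ∀ v x, q v x = 0 ↔ v ∈ H x := fun v x => QuotientAddGroup.eq_zero_iff v
  have hinj : Function.Injective q := (injective_iff_map_eq_zero q).mpr fun v hv =>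
    hH v fun x => (hq v x).mp (congrFun hv x)
  refine ⟨_, fun x => weylGroup (e x), codeState e q.range,
    fun x => isAbstractErrorGroup_weylGroup (e x), isStabiliserState_codeState e q.range, fun J => ?_⟩
  rw [reducedEntropy_codeState]
  set K := J.map Fin.castSuccEmb
  have hL : Nat.card q.range = Nat.card V :=
    (Nat.card_congr (AddMonoidHom.ofInjective hinj).toEquiv).symm
  have hoff : Nat.card {v : V // ∀ x ∉ K, v ∈ H x} = Nat.card {u : ∀ x : {x // x ∈ K}, V ⧸ H x //
      glueHom (fun x => V ⧸ H x) K (u, 0) ∈ q.range} := by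
    refine Nat.card_congr (Equiv.ofBijective (fun v => ⟨fun x => q v x, v, ?_⟩) ⟨?_, ?_⟩)
    · funext x
      by_cases hx : x ∈ K
      · simp [glueHom, hx]
      · simpa [glueHom, hx] using (hq v x).mpr (v.2 x hx)
    · intro v w h
      refine Subtype.ext (hinj (funext fun x => ?_))
      by_cases hx : x ∈ K
      · exact congrFun (congrArg Subtype.val h) ⟨x, hx⟩
      · rw [(hq v x).mpr (v.2 x hx), (hq w x).mpr (w.2 x hx)]
    · rintro ⟨u, v, hv⟩
      have h1 := fun x => congrFun hv x
      refine ⟨⟨v, fun x hx => (hq v x).mp ?_⟩, Subtype.ext (funext fun x => ?_)⟩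
      · rw [h1]
        simp [glueHom, hx]
      · change q v x = u x
        rw [h1]
        simp [glueHom]
  have hon : Nat.card {v : V // ∀ x ∈ K, v ∈ H x} = Nat.card {u : ∀ x : {x // x ∉ K}, V ⧸ H x //
      glueHom (fun x => V ⧸ H x) K (0, u) ∈ q.range} := by
    refine Nat.card_congr (Equiv.ofBijective (fun v => ⟨fun x => q v x, v, ?_⟩) ⟨?_, ?_⟩)
    · funext x
      by_cases hx : x ∈ K
      · simpa [glueHom, hx] using (hq v x).mpr (v.2 x hx)
      · simp [glueHom, hx]
    · intro v w h
      refine Subtype.ext (hinj (funext fun x => ?_))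
      by_cases hx : x ∈ K
      · rw [(hq v x).mpr (v.2 x hx), (hq w x).mpr (w.2 x hx)]
      · exact congrFun (congrArg Subtype.val h) ⟨x, hx⟩
    · rintro ⟨u, v, hv⟩
      have h1 := fun x => congrFun hv x
      refine ⟨⟨v, fun x hx => (hq v x).mp ?_⟩, Subtype.ext (funext fun x => ?_)⟩
      · rw [h1]
        simp [glueHom, hx]
      · change q v x = u x
        rw [h1]
        simp [glueHom, x.2]
  rw [hL, ← hoff, ← hon]

/-! ### Linear codes over prime fields -/

section LinearCode

variable {p k : ℕ} [NeZero p]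

/-- The vectors orthogonal to all vectors of a list. -/
def orthogonal (M : List (Fin k → ZMod p)) : AddSubgroup (Fin k → ZMod p) where
  carrier := {v | ∀ w ∈ M, w ⬝ᵥ v = 0}
  zero_mem' w _ := dotProduct_zero w
  add_mem' hu hv w hw := by rw [dotProduct_add, hu w hw, hv w hw, add_zero]
  neg_mem' hu w hw := by rw [dotProduct_neg, hu w hw, neg_zero]

/-- The rank function of a linear code, symmetrised under complements, is the entropy vector of a
stabiliser state, up to a positive factor. -/
theorem rank_mem_hull {ι : Type*} [DecidableEq ι] (hp : 1 < p) (M : ι → List (Fin k → ZMod p))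
    (rank : Finset ι → ℕ) (hrank : ∀ T : Finset ι, Nat.card
      {v : Fin k → ZMod p // ∀ t ∈ T, ∀ w ∈ M t, w ⬝ᵥ v = 0} * p ^ rank T = p ^ k)
    {N : ℕ} (τ : Fin (N + 1) → ι) (hτ : rank (Finset.univ.image τ) = k) :
    (fun J : Finset (Fin N) => (rank ((J.map Fin.castSuccEmb).image τ) +
      rank ((J.map Fin.castSuccEmb)ᶜ.image τ) - k : ℝ)) ∈
        PointedCone.hull ℝ (stabiliserEntropyVectors N) := by
  have hp0 : (p : ℝ) ≠ 0 := Nat.cast_ne_zero.mpr (NeZero.ne p)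
  have hlog : 0 < Real.log p := Real.log_pos (by exact_mod_cast hp)
  have hcard : ∀ T : Finset ι, ∀ K : Finset (Fin (N + 1)), K.image τ = T →
      Real.log (Nat.card {v : Fin k → ZMod p // ∀ x ∈ K, v ∈ orthogonal (M (τ x))}) =
        (k - rank T) * Real.log p := by
    rintro _ K rfl
    have h1 : Nat.card {v : Fin k → ZMod p // ∀ x ∈ K, v ∈ orthogonal (M (τ x))} =
        Nat.card {v : Fin k → ZMod p // ∀ t ∈ K.image τ, ∀ w ∈ M t, w ⬝ᵥ v = 0} := by
      refine Nat.card_congr (Equiv.subtypeEquivRight fun v => ?_)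
      rw [Finset.forall_mem_image]
      rfl
    have h2 := congrArg (fun m : ℕ => Real.log m) (hrank (K.image τ))
    simp only [Nat.cast_mul, Nat.cast_pow] at h2
    have h3 : (Nat.card {v : Fin k → ZMod p // ∀ t ∈ K.image τ, ∀ w ∈ M t, w ⬝ᵥ v = 0} : ℝ)
        ≠ 0 := by
      have := hrank (K.image τ)
      intro h0
      rw [Nat.cast_eq_zero.mp h0, zero_mul] at this
      exact (pow_pos (Nat.pos_of_ne_zero (NeZero.ne p)) k).ne this
    rw [Real.log_mul h3 (pow_ne_zero _ hp0), Real.log_pow, Real.log_pow] at h2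
    rw [h1]
    linarith
  -- Full rank `k` leaves a single vector orthogonal to all the chosen subspaces, which is the
  -- trivial intersection required of the family.
  have htriv : ∀ v : Fin k → ZMod p, (∀ x, v ∈ orthogonal (M (τ x))) → v = 0 := by
    have h1 := hrank (Finset.univ.image τ)
    rw [hτ] at h1
    have h2 := Nat.eq_of_mul_eq_mul_right (pow_pos (Nat.pos_of_ne_zero (NeZero.ne p)) k)
      (h1.trans (one_mul _).symm)
    rw [Nat.card_eq_fintype_card] at h2
    obtain ⟨u, hu⟩ := Fintype.card_eq_one_iff.mp h2
    intro v hv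
    have hv' := hu ⟨v, by
      rw [Finset.forall_mem_image]
      exact fun x _ => hv x⟩
    have h0 := hu ⟨0, fun t _ w _ => dotProduct_zero w⟩
    exact congrArg Subtype.val (hv'.trans h0.symm)
  have hmem := mem_stabiliserEntropyVectors_of_subgroups (fun x => orthogonal (M (τ x))) htriv
  -- Dividing by `log p` changes the unit of entropy, leaving integer values.
  have := PointedCone.smul_mem (PointedCone.hull ℝ (stabiliserEntropyVectors N))
    (inv_nonneg.mpr hlog.le) (Submodule.subset_span hmem)
  convert this using 1
  funext J
  have hV : Real.log (Nat.card (Fin k → ZMod p)) = k * Real.log p := by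
    rw [Nat.card_eq_fintype_card, Fintype.card_fun, ZMod.card, Fintype.card_fin, Nat.cast_pow,
      Real.log_pow]
  have hoff : Real.log (Nat.card {v : Fin k → ZMod p // ∀ x ∉ J.map Fin.castSuccEmb,
      v ∈ orthogonal (M (τ x))}) = (k - rank ((J.map Fin.castSuccEmb)ᶜ.image τ)) * Real.log p := by
    rw [← hcard _ _ rfl]
    simp only [Finset.mem_compl]
  rw [Pi.smul_apply, smul_eq_mul, hV, hoff, hcard _ _ rfl]
  field_simp
  ring

end LinearCode

/-! ### The three codes and the entropies that they provide. -/

/-- The rank function of sets of `w t` points in general position in a space of dimension `k`. -/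
def uniformRank {ι : Type*} (k : ℕ) (w : ι → ℕ) (T : Finset ι) : ℕ := min k (∑ t ∈ T, w t)

/-- The rank function of three planes through a common line and two points of another plane through
this line, in general position. -/
def planesRank (T : Finset (Fin 5)) : ℕ :=
  let a := (T ∩ {0, 1, 2}).card
  let b := (T ∩ {3, 4}).card
  if a = 0 then b else min 3 (a + min b 1) + 1

/-- A plane over the field with three elements, its zero subspace, and its four lines. -/
def lineCode : Fin 6 → List (Fin 2 → ZMod 3) :=
  ![[![1, 0], ![0, 1]], [], [![1, 0]], [![0, 1]], [![1, 1]], [![1, 2]]]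

/-- The six points of a conic over the field with five elements, the first two put together. -/
def conicCode : Fin 5 → List (Fin 3 → ZMod 5) :=
  ![[![1, 0, 0], ![0, 0, 1]], [![1, 1, 1]], [![1, 2, 4]], [![1, 3, 4]], [![1, 4, 1]]]

/-- Three planes through a common line and two points of another plane through this line. -/
def planesCode : Fin 5 → List (Fin 4 → ZMod 2) :=
  ![[![1, 0, 0, 0], ![0, 1, 0, 0]], [![1, 0, 0, 0], ![0, 0, 1, 0]], [![1, 0, 0, 0], ![0, 0, 0, 1]],
    [![0, 1, 1, 1]], [![1, 1, 1, 1]]]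

/-- Any two of the four lines span the plane. -/
theorem card_lineCode : ∀ T : Finset (Fin 6), Fintype.card
    {v : Fin 2 → ZMod 3 // ∀ t ∈ T, ∀ w ∈ lineCode t, w ⬝ᵥ v = 0} *
      3 ^ uniformRank 2 ![2, 0, 1, 1, 1, 1] T = 3 ^ 2 := by decide +kernel

/-- Besides `(1, 0, 0)` and `(0, 0, 1)` the points are `(1, t, t²)` with `t ≠ 0`; any three points
of a conic are independent. -/
theorem card_conicCode : ∀ T : Finset (Fin 5), Fintype.card
    {v : Fin 3 → ZMod 5 // ∀ t ∈ T, ∀ w ∈ conicCode t, w ⬝ᵥ v = 0} *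
      5 ^ uniformRank 3 ![2, 1, 1, 1, 1] T = 5 ^ 3 := by decide +kernel

/-- Modulo the common vector `(1, 0, 0, 0)` the three planes become the unit vectors of a
three-dimensional space and both points become `(1, 1, 1)`: four vectors of which any three are
independent. -/
theorem card_planesCode : ∀ T : Finset (Fin 5), Fintype.card
    {v : Fin 4 → ZMod 2 // ∀ t ∈ T, ∀ w ∈ planesCode t, w ⬝ᵥ v = 0} *
      2 ^ planesRank T = 2 ^ 4 := by decide +kernel

/-- A choice, for each of five parties, of one of the subspaces of one of the codes. -/
inductive Assignment
  | line (τ : Fin 5 → Fin 6)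
  | conic (τ : Fin 5 → Fin 5)
  | planes (τ : Fin 5 → Fin 5)

/-- The rank of the subspaces chosen for a set of parties. -/
def Assignment.rank : Assignment → Finset (Fin 5) → ℕ
  | line τ, K => uniformRank 2 ![2, 0, 1, 1, 1, 1] (K.image τ)
  | conic τ, K => uniformRank 3 ![2, 1, 1, 1, 1] (K.image τ)
  | planes τ, K => planesRank (K.image τ)

/-- The dimension of the space of the code of an assignment. -/
def Assignment.dim : Assignment → ℕ
  | line _ => 2
  | conic _ => 3
  | planes _ => 4

/-- The entropy, in units of the logarithm of the characteristic, of the parties in `K`. -/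
def Assignment.entropy (a : Assignment) (K : Finset (Fin 5)) : ℤ :=
  a.rank K + a.rank Kᶜ - a.dim

theorem Assignment.mem_hull (a : Assignment) (ha : a.rank Finset.univ = a.dim) :
    (fun J : Finset (Fin 4) => (a.entropy (J.map Fin.castSuccEmb) : ℝ)) ∈
      PointedCone.hull ℝ (stabiliserEntropyVectors 4) := by
  cases a with
  | line τ =>
    have := rank_mem_hull (p := 3) (by norm_num) lineCode (uniformRank 2 ![2, 0, 1, 1, 1, 1])
      (fun T => by rw [Nat.card_eq_fintype_card]; exact card_lineCode T) τ ha
    simpa only [Assignment.entropy, Assignment.rank, Assignment.dim, Int.cast_sub, Int.cast_add,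
      Int.cast_natCast] using this
  | conic τ =>
    have := rank_mem_hull (p := 5) (by norm_num) conicCode (uniformRank 3 ![2, 1, 1, 1, 1])
      (fun T => by rw [Nat.card_eq_fintype_card]; exact card_conicCode T) τ ha
    simpa only [Assignment.entropy, Assignment.rank, Assignment.dim, Int.cast_sub, Int.cast_add,
      Int.cast_natCast] using this
  | planes τ =>
    have := rank_mem_hull (p := 2) (by norm_num) planesCode planesRank
      (fun T => by rw [Nat.card_eq_fintype_card]; exact card_planesCode T) τ ha
    simpa only [Assignment.entropy, Assignment.rank, Assignment.dim, Int.cast_sub, Int.cast_add,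
      Int.cast_natCast] using this

/-! ### The cone of the poly-quantoids that satisfy the Ingleton inequality -/

/-- The inequalities `I(i : j) ≥ 0`, `I(i : j | k) ≥ 0` and `Ing(i j : k l) ≥ 0` for five parties. -/
inductive Facet
  | mi (i j : Fin 5)
  | cmi (i j k : Fin 5)
  | ing (i j k l : Fin 5)

/-- The mutual information of two sets, for a function on the binary encodings of sets. -/
def evalMI {R : Type*} [Add R] [Sub R] (s : ℕ → R) (a b : ℕ) : R := s a + s b - s (a ||| b)

/-- The conditional mutual information, for a function on the binary encodings of sets. -/
def evalCMI {R : Type*} [Add R] [Sub R] (s : ℕ → R) (a b c : ℕ) : R :=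
  s (a ||| c) + s (b ||| c) - s (a ||| b ||| c) - s c

/-- The left-hand side of an inequality, for a function on the binary encodings of sets. -/
def Facet.eval {R : Type*} [Add R] [Sub R] (s : ℕ → R) : Facet → R
  | mi i j => evalMI s (2 ^ i.1) (2 ^ j.1)
  | cmi i j k => evalCMI s (2 ^ i.1) (2 ^ j.1) (2 ^ k.1)
  | ing i j k l => evalCMI s (2 ^ i.1) (2 ^ j.1) (2 ^ k.1) +
      evalCMI s (2 ^ i.1) (2 ^ j.1) (2 ^ l.1) + evalMI s (2 ^ k.1) (2 ^ l.1) -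
      evalMI s (2 ^ i.1) (2 ^ j.1)

/-- The parties of an inequality are distinct. -/
def Facet.distinct : Facet → Bool
  | mi i j => i != j
  | cmi i j k => i != j && i != k && j != k
  | ing i j k l => i != j && i != k && i != l && j != k && j != l && k != l

/-- The facets of the cone, in an order in which the double description method is fast. -/
def facets : List Facet :=
  [.cmi 2 3 1, .ing 0 1 2 4, .cmi 0 2 1, .cmi 1 4 2,
    .cmi 0 4 1, .cmi 2 4 1, .cmi 2 4 0, .cmi 3 4 0,
    .cmi 1 3 0, .cmi 1 4 3, .cmi 0 1 3, .cmi 0 3 1,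
    .cmi 1 2 0, .mi 1 2, .cmi 0 1 4, .cmi 2 3 0, .cmi 3 4 1,
    .ing 0 1 2 3, .ing 0 1 3 4, .cmi 0 1 2, .cmi 1 4 0,
    .cmi 1 3 2, .ing 1 3 0 2, .ing 1 3 2 4, .cmi 2 4 3,
    .cmi 0 2 3, .ing 0 3 2 4, .ing 0 3 1 4, .cmi 0 3 2,
    .ing 0 2 1 4, .ing 0 2 1 3, .ing 2 3 0 1, .ing 2 3 1 4,
    .cmi 3 4 2, .ing 0 2 3 4, .cmi 0 4 3, .ing 1 3 0 4,
    .cmi 0 4 2, .ing 2 3 0 4, .cmi 1 2 3, .ing 0 3 1 2,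
    .ing 1 2 0 3, .ing 1 2 3 4, .ing 1 2 0 4, .cmi 0 2 4,
    .cmi 1 2 4, .cmi 0 3 4, .cmi 1 3 4, .cmi 2 3 4,
    .ing 2 4 1 3, .ing 2 4 0 3, .ing 2 4 0 1, .ing 0 4 1 3, .ing 0 4 1 2,
    .ing 0 4 2 3, .ing 3 4 1 2, .ing 3 4 0 2, .ing 3 4 0 1, .ing 1 4 0 3,
    .ing 1 4 0 2, .ing 1 4 2 3, .mi 0 1, .mi 0 4, .mi 2 4, .mi 0 2,
    .mi 1 4, .mi 3 4, .mi 1 3, .mi 0 3, .mi 2 3]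

/-- The generators of the cone cut out by the first fifteen facets, each given by its values on the
sets of the first four parties. -/
def baseRays : List (List ℤ) :=
  [[0, 0, 0, 0, 1, 1, 1, 1, 1, 1, 1, 1, 0, 0, 0, 0],
   [0, -1, 0, -1, 0, -1, 0, -1, 0, -1, 0, -1, -2, -1, 0, 1],
   [0, 1, 0, 1, 1, 0, 1, 0, 0, 1, 0, 1, 1, 0, 1, 0],
   [0, 2, 2, 2, 0, 2, 2, 2, 2, 2, 2, 2, 2, 2, 2, 2],
   [0, 1, 0, 1, 0, 1, 0, 1, 0, 1, 0, 1, 0, 1, 0, 1],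
   [0, 0, 0, 0, 0, 0, 0, 0, 0, 0, 0, 0, 2, 2, 0, 0],
   [0, 1, 0, 1, 1, 2, 1, 2, 0, 1, 0, 1, 1, 0, 1, 0],
   [0, 0, 0, 0, 0, 0, 0, 0, 1, 1, 1, 1, 1, 1, 1, 1],
   [0, 0, 1, 1, 0, 0, 1, 1, 1, 1, 0, 0, 1, 1, 0, 0],
   [0, -2, -1, -1, 0, -2, -1, -1, -2, -2, -1, -1, -2, -2, -1, -1],
   [0, 2, 1, 1, 0, 2, 1, 1, 0, 2, 1, 1, 2, 2, 1, 1],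
   [0, 1, 0, 1, 0, 1, 0, 1, 1, 0, 1, 0, 1, 0, 1, 0],
   [0, -2, -1, -1, -1, -1, -2, -2, -2, -2, -1, -1, -1, -1, -2, -2],
   [0, 2, 2, 2, 2, 2, 2, 2, 2, 2, 2, 2, 2, 2, 2, 2],
   [0, 0, 0, 0, 0, 0, 0, 0, 0, 0, 0, 0, 0, 0, 0, -2]]

/-- The stabiliser states on the extreme rays of the cone, in the order of the output of the double
description method. -/
def assignments : List Assignment :=
  [.line ![2, 0, 3, 4, 0], .conic ![1, 2, 0, 3, 4], .planes ![0, 1, 3, 4, 2],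
    .conic ![1, 2, 3, 0, 4], .line ![0, 0, 2, 3, 4], .line ![0, 2, 3, 4, 0],
    .planes ![3, 0, 1, 2, 4], .line ![1, 0, 0, 0, 0], .line ![1, 1, 0, 0, 1],
    .planes ![3, 4, 0, 1, 2], .line ![0, 2, 0, 3, 4], .line ![0, 0, 0, 0, 1],
    .line ![2, 3, 0, 0, 4], .line ![0, 2, 3, 0, 4], .line ![0, 0, 0, 0, 0],
    .line ![2, 3, 4, 0, 0], .line ![2, 0, 3, 0, 4], .planes ![0, 3, 1, 2, 4],
    .line ![0, 1, 0, 0, 0], .line ![2, 0, 0, 3, 4], .line ![2, 3, 0, 4, 0],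
    .conic ![1, 0, 2, 3, 4], .planes ![0, 3, 1, 4, 2], .planes ![0, 1, 2, 3, 4],
    .line ![1, 0, 1, 0, 1], .planes ![3, 0, 4, 1, 2], .line ![1, 0, 1, 1, 0],
    .line ![1, 1, 0, 1, 0], .line ![1, 0, 0, 1, 1], .line ![0, 0, 1, 1, 1],
    .line ![2, 1, 3, 4, 5], .line ![2, 3, 4, 5, 1], .line ![1, 2, 3, 4, 5],
    .line ![2, 3, 1, 4, 5], .line ![2, 3, 4, 1, 5], .line ![0, 1, 1, 1, 0],
    .line ![0, 1, 0, 1, 1], .line ![1, 1, 1, 0, 0], .line ![0, 0, 0, 1, 0],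
    .conic ![1, 2, 3, 4, 0], .planes ![0, 1, 3, 2, 4], .line ![0, 0, 1, 0, 0],
    .line ![0, 1, 1, 0, 1], .planes ![0, 3, 4, 1, 2], .conic ![0, 1, 2, 3, 4],
    .planes ![3, 0, 1, 4, 2]]

/-- The encoding of a set of five parties or of its complement, whichever does not contain the last
party. -/
def fold (m : ℕ) : ℕ := if m < 16 then m else 31 - m

/-- The values at the facets, followed by the values at the sets of the first four parties. -/
def slack (r : List ℤ) : List ℤ := facets.map (Facet.eval fun m => r.getD (fold m) 0) ++ r

/-- The generators of the cone cut out by the first fifteen facets. -/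
def baseCone : List Ray := (List.range 15).map fun j => (2 ^ j, slack (baseRays.getD j []))

/-- The set of the first four parties with a given binary encoding. -/
def setOf (m : ℕ) : Finset (Fin 4) := Finset.univ.filter fun i => m.testBit i

/-- A ray is, up to a factor, the entropy vector of an assignment. -/
def isEntropyRay (l : List ℤ) (a : Assignment) : Bool :=
  -- The first 70 entries are the facet values; the last 16 are the vector itself.
  let r := l.drop 70
  let v := (List.range 16).map fun m => a.entropy ((setOf m).map Fin.castSuccEmb)
  -- Cross-multiplying by the sums of the entries tests proportionality in integers; the signs of
  -- the sums make the factor `r.sum / v.sum` non-negative.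
  decide (a.rank Finset.univ = a.dim) && decide (0 ≤ r.sum) && decide (0 < v.sum) &&
    decide (v.map (r.sum * ·) = r.map (v.sum * ·))

/-- The whole computation: the remaining 55 facets are cut off in turn, and each ray of the output
is matched with its stabiliser state. -/
theorem cuts_baseCone : (let R := cuts 55 15 baseCone
    decide (R.length = assignments.length) &&
      (R.zip assignments).all fun p => isEntropyRay p.1.2 p.2) = true := by
  decide +kernel

/-! ### The facet inequalities for a poly-quantoid -/

theorem restrictParties_compl {N : ℕ} (A : Finset (Fin (N + 1))) :
    restrictParties Aᶜ = (restrictParties A)ᶜ := by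
  ext; simp [restrictParties]

theorem restrictParties_inter {N : ℕ} (A B : Finset (Fin (N + 1))) :
    restrictParties (A ∩ B) = restrictParties A ∩ restrictParties B := by
  ext; simp [restrictParties]

theorem restrictParties_union {N : ℕ} (A B : Finset (Fin (N + 1))) :
    restrictParties (A ∪ B) = restrictParties A ∪ restrictParties B := by
  ext; simp [restrictParties]

theorem IsPolyQuantoid.purification_empty {N : ℕ} {S : Finset (Fin N) → ℝ}
    (hS : IsPolyQuantoid S) : purification S ∅ = 0 := by
  simpa [purification, restrictParties] using hS.empty

/-- The purification of a poly-quantoid is strongly subadditive. -/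
theorem IsPolyQuantoid.purification_ssa {N : ℕ} {S : Finset (Fin N) → ℝ}
    (hS : IsPolyQuantoid S) (A B : Finset (Fin (N + 1))) :
    purification S (A ∩ B) + purification S (A ∪ B) ≤ purification S A + purification S B := by
  -- The cases are whether `A` and `B` contain the purifying party: strong subadditivity for the
  -- restrictions if neither does, for their complements if both do, and weak monotonicity if
  -- exactly one does.
  have h1 := hS.ssa (restrictParties A) (restrictParties B)
  have h2 := hS.ssa (restrictParties A)ᶜ (restrictParties B)ᶜ
  have h3 := hS.wmo (restrictParties A)ᶜ (restrictParties B)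
  have h4 := hS.wmo (restrictParties A) (restrictParties B)ᶜ
  rw [← Finset.compl_union, ← Finset.compl_inter] at h2
  rw [Finset.sdiff_eq_inter_compl, ← Finset.compl_union, Finset.sdiff_eq_inter_compl, compl_compl,
    Finset.inter_comm (restrictParties B)] at h3
  rw [Finset.sdiff_eq_inter_compl, compl_compl, Finset.sdiff_eq_inter_compl, ← Finset.compl_union,
    Finset.union_comm (restrictParties B)] at h4
  simp only [purification, Finset.mem_inter, Finset.mem_union, restrictParties_compl,
    restrictParties_inter, restrictParties_union]
  by_cases hA : Fin.last N ∈ A <;> by_cases hB : Fin.last N ∈ B <;>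
    simp only [hA, hB, and_true, and_false, or_true, or_false, if_true, if_false] <;> linarith

/-- The set of parties with a given binary encoding. -/
def partySet (m : ℕ) : Finset (Fin 5) := Finset.univ.filter fun i => m.testBit i

theorem partySet_or (a b : ℕ) : partySet (a ||| b) = partySet a ∪ partySet b := by
  ext; simp [partySet]

theorem partySet_two_pow (i : Fin 5) : partySet (2 ^ i.1) = {i} := by
  ext j
  simp [partySet, Nat.testBit_two_pow, Fin.ext_iff, eq_comm]

theorem purification_partySet (S : Finset (Fin 4) → ℝ) {m : ℕ} (hm : m < 2 ^ 5) :
    purification S (partySet m) = S (setOf (fold m)) := by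
  have key : ∀ m < 2 ^ 5, (if Fin.last 4 ∈ partySet m then restrictParties (partySet m)ᶜ
      else restrictParties (partySet m)) = setOf (fold m) := by decide +kernel
  rw [← key m hm, purification]
  split_ifs <;> rfl

theorem two_pow_lt (i : Fin 5) : 2 ^ i.1 < 2 ^ 5 := Nat.pow_lt_pow_right (by norm_num) i.2

theorem evalMI_eq (S : Finset (Fin 4) → ℝ) (i j : Fin 5) :
    evalMI (fun m => S (setOf (fold m))) (2 ^ i.1) (2 ^ j.1) =
      mutualInfo (purification S) {i} {j} := by
  have hi := two_pow_lt i
  have hj := two_pow_lt j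
  rw [evalMI, ← purification_partySet S hi, ← purification_partySet S hj,
    ← purification_partySet S (Nat.or_lt_two_pow hi hj)]
  simp only [mutualInfo, partySet_or, partySet_two_pow]

theorem evalCMI_eq (S : Finset (Fin 4) → ℝ) (i j k : Fin 5) :
    evalCMI (fun m => S (setOf (fold m))) (2 ^ i.1) (2 ^ j.1) (2 ^ k.1) =
      condMutualInfo (purification S) {i} {j} {k} := by
  have hi := two_pow_lt i
  have hj := two_pow_lt j
  have hk := two_pow_lt k
  rw [evalCMI, ← purification_partySet S (Nat.or_lt_two_pow hi hk),
    ← purification_partySet S (Nat.or_lt_two_pow hj hk), ← purification_partySet S hk,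
    ← purification_partySet S (Nat.or_lt_two_pow (Nat.or_lt_two_pow hi hj) hk)]
  simp only [condMutualInfo, partySet_or, partySet_two_pow]

theorem SatisfiesIngleton.ingleton_nonneg {S : Finset (Fin 4) → ℝ} (h : SatisfiesIngleton S)
    {i j k l : Fin 5} (hd : (Facet.ing i j k l).distinct = true) :
    0 ≤ ingleton (purification S) {i} {j} {k} {l} := by
  have hex : ∀ i j k l : Fin 5, ∃ m : Fin 5, m ≠ i ∧ m ≠ j ∧ m ≠ k ∧ m ≠ l := by decide +kernel
  -- The fifth party completes the four to a permutation.
  obtain ⟨m, hm⟩ := hex i j k l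
  have hinj : Function.Injective ![i, j, k, l, m] := by
    simp only [Facet.distinct, Bool.and_eq_true, bne_iff_ne] at hd
    intro a b hab
    fin_cases a <;> fin_cases b <;> simp_all [eq_comm]
  exact h (Equiv.ofBijective _ (Finite.injective_iff_bijective.mp hinj))

theorem Facet.eval_nonneg {S : Finset (Fin 4) → ℝ} (hS : IsPolyQuantoid S)
    (h : SatisfiesIngleton S) (f : Facet) (hd : f.distinct = true) :
    0 ≤ f.eval fun m => S (setOf (fold m)) := by
  cases f with
  | mi i j =>
    rw [Facet.eval, evalMI_eq, mutualInfo]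
    have hij : i ≠ j := by simpa [Facet.distinct] using hd
    have := hS.purification_ssa {i} {j}
    rw [Finset.singleton_inter_of_notMem (by simpa using hij), hS.purification_empty] at this
    linarith
  | cmi i j k =>
    rw [Facet.eval, evalCMI_eq, condMutualInfo]
    have hd' : (i ≠ j ∧ i ≠ k) ∧ j ≠ k := by simpa [Facet.distinct] using hd
    have := hS.purification_ssa ({i} ∪ {k}) ({j} ∪ {k})
    rw [← Finset.inter_union_distrib_right, ← Finset.union_union_distrib_right,
      Finset.singleton_inter_of_notMem (by simpa using hd'.1.1), Finset.empty_union] at this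
    linarith
  | ing i j k l =>
    rw [Facet.eval, evalCMI_eq, evalCMI_eq, evalMI_eq, evalMI_eq]
    exact h.ingleton_nonneg hd

/-! ### Slack sequences -/

theorem Facet.eval_add (s t : ℕ → ℝ) (f : Facet) : f.eval (s + t) = f.eval s + f.eval t := by
  cases f <;> simp only [Facet.eval, evalMI, evalCMI, Pi.add_apply] <;> ring

theorem Facet.eval_smul (c : ℝ) (s : ℕ → ℝ) (f : Facet) : f.eval (c • s) = c • f.eval s := by
  cases f <;> simp only [Facet.eval, evalMI, evalCMI, Pi.smul_apply, smul_eq_mul] <;> ring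

theorem Facet.eval_intCast (s : ℕ → ℤ) (f : Facet) :
    f.eval (fun m => (s m : ℝ)) = (f.eval s : ℤ) := by
  cases f <;> simp only [Facet.eval, evalMI, evalCMI] <;> push_cast <;> rfl

/-- The values at the facets, followed by the values at the sets of the first four parties. -/
def slackSeq : (ℕ → ℝ) →ₗ[ℝ] (ℕ → ℝ) where
  toFun s i := if h : i < facets.length then facets[i].eval fun m => s (fold m)
    else s (i - facets.length)
  map_add' s t := by
    funext i
    simp only [Pi.add_apply]
    split_ifs
    · exact Facet.eval_add _ _ _
    · rfl
  map_smul' c s := by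
    funext i
    simp only [Pi.smul_apply]
    split_ifs
    · exact Facet.eval_smul _ _ _
    · rfl

theorem length_facets : facets.length = 70 := by decide +kernel

theorem seq_slack (r : List ℤ) : seq (slack r) = slackSeq (seq r) := by
  funext i
  simp only [seq, slack, slackSeq, LinearMap.coe_mk, AddHom.coe_mk]
  split_ifs with h
  · rw [Facet.eval_intCast, List.getD_append _ _ _ _ (by simpa using h),
      List.getD_eq_getElem _ _ (by simpa using h), List.getElem_map]
  · rw [List.getD_append_right _ _ _ _ (by simpa using h), List.length_map]

/-- The `j`-th generator of the cone cut out by the first fifteen facets. -/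
def baseSeq (j : ℕ) : ℕ → ℝ := seq (slack (baseRays.getD j []))

/-- The slack sequences, in terms of the values at the first fifteen facets. -/
def slackSpace : Submodule ℝ (ℕ → ℝ) :=
  LinearMap.eqLocus ((2 : ℝ) • LinearMap.id)
    (∑ j ∈ Finset.range 15, (LinearMap.proj j).smulRight (baseSeq j))

theorem mem_slackSpace {x : ℕ → ℝ} :
    x ∈ slackSpace ↔ (2 : ℝ) • x = ∑ j ∈ Finset.range 15, x j • baseSeq j := by
  simp [slackSpace, LinearMap.mem_eqLocus]

/-- The base rays are twice the basis dual to the first fifteen facets, the factor 2 keeping the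
entries integral; these facets therefore cut out a simplicial cone, where the method starts. -/
theorem slack_baseRays : ∀ j < 15, ∀ i < 15,
    (slack (baseRays.getD j [])).getD i 0 = if i = j then 2 else 0 := by
  decide +kernel

theorem generates_baseCone : Generates slackSpace 15 baseCone := by
  have hmem : ∀ r, r ∈ baseCone ↔ ∃ j < 15, (2 ^ j, slack (baseRays.getD j [])) = r := fun r => by
    simp only [baseCone, List.mem_map, List.mem_range]
  constructor
  · intro r hr
    obtain ⟨j, hj, rfl⟩ := (hmem r).mp hr
    rw [mem_slackSpace, Finset.sum_eq_single_of_mem j (Finset.mem_range.mpr hj)]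
    · simp only [seq, slack_baseRays j hj j hj, if_true]
      rfl
    · intro i hi hij
      simp only [seq, slack_baseRays j hj i (Finset.mem_range.mp hi), if_neg hij, Int.cast_zero,
        zero_smul]
  · intro r hr i hi
    obtain ⟨j, hj, rfl⟩ := (hmem r).mp hr
    rw [slack_baseRays j hj i hi]
    split_ifs <;> simp
  · intro r hr i
    obtain ⟨j, hj, rfl⟩ := (hmem r).mp hr
    rw [Nat.testBit_two_pow, decide_eq_true_eq]
    constructor
    · rintro rfl
      exact ⟨hj, by rw [slack_baseRays j hj j hj]; simp⟩
    · rintro ⟨hi, h0⟩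
      rw [slack_baseRays j hj i hi] at h0
      by_contra hne
      simp [Ne.symm hne] at h0
  · intro r hr
    obtain ⟨j, hj, rfl⟩ := (hmem r).mp hr
    exact ⟨j, hj, by rw [slack_baseRays j hj j hj]; simp⟩
  · intro x hx h0
    have hx2 : x = ∑ j ∈ Finset.range 15, (x j / 2) • baseSeq j := by
      rw [mem_slackSpace] at hx
      rw [← smul_right_injective _ (two_ne_zero (α := ℝ)) |>.eq_iff, hx, Finset.smul_sum]
      refine Finset.sum_congr rfl fun j _ => ?_
      rw [smul_smul, mul_div_cancel₀ _ two_ne_zero]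
    rw [hx2]
    refine Submodule.sum_mem _ fun j hj => ?_
    have hj' := Finset.mem_range.mp hj
    exact (rayCone baseCone).smul_mem (div_nonneg (h0 j hj') zero_le_two)
      (seq_mem_rayCone ((hmem _).mpr ⟨j, hj', rfl⟩))

/-- The `n`-th unit vector, as a function on the encodings of the sets of four parties. -/
def unitList (n : ℕ) : List ℤ := (List.range 16).map fun m => if m = n then 1 else 0

/-- The dual basis relation in the other direction: fifteen facet values recover a vector. The index
`0` is excluded because the empty set has entropy zero. -/
theorem unitList_baseRays : ∀ n ∈ Finset.Ico 1 16, ∀ m < 16,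
    2 * (unitList n).getD m 0 = ∑ j ∈ Finset.range 15,
      (slack (unitList n)).getD j 0 * (baseRays.getD j []).getD m 0 := by
  decide +kernel

theorem slackSeq_mem_slackSpace {T : ℕ → ℝ} (h0 : T 0 = 0) (h16 : ∀ n, 16 ≤ n → T n = 0) :
    slackSeq T ∈ slackSpace := by
  have hunit : ∀ n m, (unitList n).getD m 0 = if m < 16 ∧ m = n then 1 else 0 := by
    intro n m
    by_cases hm : m < 16
    · rw [unitList, List.getD_eq_getElem _ _ (by simpa using hm)]
      simp [hm]
    · rw [unitList, List.getD_eq_default _ _ (by simpa using hm)]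
      simp [hm]
  -- The sequence is expanded in unit vectors, so that membership reduces to the integer identity
  -- `unitList_baseRays`.
  have hT : T = ∑ n ∈ Finset.Ico 1 16, T n • seq (unitList n) := by
    funext m
    simp only [Finset.sum_apply, Pi.smul_apply, seq, hunit, smul_eq_mul]
    by_cases hm : m ∈ Finset.Ico 1 16
    · rw [Finset.sum_eq_single_of_mem m hm]
      · simp [(Finset.mem_Ico.mp hm).2]
      · intro n _ hn
        simp [hn.symm]
    · rw [Finset.sum_eq_zero]
      · rw [Finset.mem_Ico] at hm
        rcases Nat.eq_zero_or_pos m with rfl | hpos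
        · exact h0
        · exact h16 m (by lia)
      · intro n hn
        rw [if_neg]
        · simp
        · rintro ⟨-, rfl⟩
          exact hm hn
  have hlen : ∀ j < 15, (baseRays.getD j []).length = 16 := by decide +kernel
  rw [hT, map_sum]
  refine Submodule.sum_mem _ fun n hn => ?_
  rw [map_smul]
  refine slackSpace.smul_mem _ ?_
  have hkey : (2 : ℝ) • seq (unitList n) = ∑ j ∈ Finset.range 15,
      slackSeq (seq (unitList n)) j • seq (baseRays.getD j []) := by
    funext m
    simp only [Finset.sum_apply, Pi.smul_apply, smul_eq_mul]
    by_cases hm : m < 16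
    · have := unitList_baseRays n hn m hm
      simp only [← seq_slack]
      simp only [seq]
      exact_mod_cast this
    · rw [Finset.sum_eq_zero fun j hj => ?_]
      · simp [seq, hunit, hm, -List.getD_eq_getElem?_getD]
      · rw [seq, List.getD_eq_default _ _
          (by rw [hlen j (Finset.mem_range.mp hj)]; exact not_lt.mp hm), Int.cast_zero, mul_zero]
  rw [mem_slackSpace, ← map_smul, hkey, map_sum]
  exact Finset.sum_congr rfl fun j _ => by rw [map_smul, baseSeq, seq_slack]

/-! ### Reading off the four-party vector and concluding. -/

/-- The encoding of a set of the first four parties. -/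
def encode (J : Finset (Fin 4)) : ℕ := ∑ i ∈ J, 2 ^ i.1

theorem encode_lt : ∀ J, encode J < 16 := by decide +kernel

theorem setOf_encode : ∀ J, setOf (encode J) = J := by decide +kernel

/-- The four-party vector that a sequence lists after the values at the facets. -/
def readVector : (ℕ → ℝ) →ₗ[ℝ] (Finset (Fin 4) → ℝ) where
  toFun x J := x (facets.length + encode J)
  map_add' _ _ := rfl
  map_smul' _ _ := rfl

theorem readVector_mem_hull {l : List ℤ} {a : Assignment} (h : isEntropyRay l a = true) :
    readVector (seq l) ∈ PointedCone.hull ℝ (stabiliserEntropyVectors 4) := by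
  simp only [isEntropyRay, Bool.and_eq_true, decide_eq_true_eq] at h
  obtain ⟨⟨⟨ha, hr⟩, hv⟩, heq⟩ := h
  set r := l.drop 70 with hrdef
  set v := (List.range 16).map fun m => a.entropy ((setOf m).map Fin.castSuccEmb) with hvdef
  have hentry : ∀ J, readVector (seq l) J = ((r.sum : ℝ) / v.sum) *
      a.entropy (J.map Fin.castSuccEmb) := by
    intro J
    have h1 := congrArg (fun w : List ℤ => w.getD (encode J) 0) heq
    have h2 : ∀ (c : ℤ) (w : List ℤ), (w.map (c * ·)).getD (encode J) 0 =
        c * w.getD (encode J) 0 := fun c w => by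
      simpa using List.getD_map (f := (c * ·)) (l := w) (d := 0) (n := encode J)
    simp only [h2] at h1
    have h3 : v.getD (encode J) 0 = a.entropy (J.map Fin.castSuccEmb) := by
      rw [hvdef, List.getD_eq_getElem _ _ (by simpa using encode_lt J), List.getElem_map,
        List.getElem_range, setOf_encode]
    have h4 : readVector (seq l) J = (r.getD (encode J) 0 : ℤ) := by
      simp [readVector, seq, length_facets, hrdef]
    rw [h3] at h1
    have hv' : (v.sum : ℝ) ≠ 0 := Int.cast_ne_zero.mpr hv.ne'
    have h5 : (r.sum : ℝ) * a.entropy (J.map Fin.castSuccEmb) =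
        v.sum * (r.getD (encode J) 0 : ℤ) := by exact_mod_cast h1
    rw [h4, div_mul_eq_mul_div, eq_div_iff hv', h5, mul_comm]
  have hmem := (PointedCone.hull ℝ (stabiliserEntropyVectors 4)).smul_mem
    (div_nonneg (Int.cast_nonneg hr : (0 : ℝ) ≤ r.sum) (Int.cast_nonneg hv.le : (0 : ℝ) ≤ v.sum))
    (a.mem_hull ha)
  convert hmem using 1
  exact funext hentry

theorem exists_mem_zip {α β : Type*} {l : List α} {l' : List β} (h : l.length = l'.length) {a : α}
    (ha : a ∈ l) : ∃ b, (a, b) ∈ l.zip l' := by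
  obtain ⟨i, hi, rfl⟩ := List.mem_iff_getElem.mp ha
  exact ⟨l'[i], List.mem_iff_getElem.mpr
    ⟨i, by rw [List.length_zip]; exact lt_min hi (h ▸ hi), List.getElem_zip⟩⟩

theorem IsPolyQuantoid.isStabiliserRepresented {S : Finset (Fin 4) → ℝ} (hS : IsPolyQuantoid S)
    (h : SatisfiesIngleton S) : IsStabiliserRepresented S := by
  -- Entries from 16 on are set to zero because `slackSpace` constrains entire sequences.
  set T : ℕ → ℝ := fun n => if n < 16 then S (setOf n) else 0 with hTdef
  have hT : ∀ m, T (fold m) = S (setOf (fold m)) := by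
    intro m
    have : fold m < 16 := by
      simp only [fold]
      split_ifs <;> lia
    rw [hTdef]
    exact if_pos this
  have hmem : slackSeq T ∈ slackSpace := slackSeq_mem_slackSpace
    ((if_pos (by norm_num)).trans hS.empty) fun n hn => if_neg (not_lt.mpr hn)
  have hdist : ∀ f ∈ facets, f.distinct = true := by
    have : facets.all Facet.distinct = true := by decide +kernel
    exact List.all_eq_true.mp this
  have hnonneg : ∀ i < 15 + 55, 0 ≤ slackSeq T i := by
    intro i hi
    have hi' : i < facets.length := by rw [length_facets]; exact hi
    have : slackSeq T i = facets[i].eval fun m => T (fold m) := dif_pos hi'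
    rw [this]
    simp only [hT]
    exact Facet.eval_nonneg hS h _ (hdist _ (List.getElem_mem hi'))
  have hgen := (generates_baseCone.cuts 55 15).gen _ hmem hnonneg
  have hle : rayCone (cuts 55 15 baseCone) ≤
      (PointedCone.hull ℝ (stabiliserEntropyVectors 4)).comap readVector := by
    refine rayCone_le fun r hr => ?_
    have hcuts := cuts_baseCone
    simp only [Bool.and_eq_true, decide_eq_true_eq, List.all_eq_true] at hcuts
    obtain ⟨a, ha⟩ := exists_mem_zip hcuts.1 hr
    exact readVector_mem_hull (hcuts.2 _ ha)
  have hS' : readVector (slackSeq T) = S := by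
    funext J
    have : slackSeq T (facets.length + encode J) = T (encode J) := by
      simp [slackSeq]
    exact this.trans ((if_pos (encode_lt J)).trans (by rw [setOf_encode]))
  -- The vector lies in the cone itself; no limit is needed in this direction.
  refine subset_closure ?_
  rw [← hS']
  exact hle hgen

end StabCone

end

theorem mainTheorem1 (S : Finset (Fin 4) → ℝ) (hS : StabCone.IsPolyQuantoid S) :
    StabCone.IsStabiliserRepresented S ↔ StabCone.SatisfiesIngleton S :=
  ⟨fun h => h.satisfiesIngleton, fun h => hS.isStabiliserRepresented h⟩
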